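/- **Setup.** For a positive integer $m$ let $G_m=\{0,1/m,2/m,\dots,1\}$. For $p\in[0,1]$ let $\tau_m(p)$ be the distribution on $G_m$ that rounds $p$ up or down to a closest multiple of $1/m$, with probabilities chosen so that the mean is $p$ (so $p$ is unchanged if $p\in G_m$). For a distribution $\mathcal D$ of $(p,y)\in[0,1]\times\{0,1\}$ let $\mathcal D_m$ be the distribution of $(p',y)$ where $(p,y)\sim\mathcal D$ and $p'\sim\tau_m(p)$. For $i=0,\dots,m$ put $\pi_i=\Pr_{\mathcal D_m}[p'=i/m]$ and $q_i=\mathbb E_{\mathcal D_m}[y\mid p'=i/m]$ (terms with $\pi_i=0$ are read as $0$), and, with $x_+=\max\{x,0\}$, $$\mathsf{SCDL}_m(\mathcal D)=\max_{0\le i\le m}\Big(\sum_{j=0}^{i}\pi_j\big(q_j-\tfrac{i+1}{m}\big)_+ +\sum_{j=i+1}^{m}\pi_j\big(\tfrac im-q_j\big)_+\Big),\qquad \mathsf{SCDL}(\mathcal D)=\inf_{m\in\{2^1,2^2,\dots\}}\max\{\mathsf{SCDL}_m(\mathcal D),1/m\}.$$ A decision task $Z=(A,U)$ consists of an arbitrary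 action set $A$ and a utility function $U:A\times\{0,1\}\to[0,1]$. A best-response function is a map $r_Z^*:[0,1]\to A$ with $r_Z^*(p)\in\operatorname{argmax}_{a\in A}\mathbb E_{y\sim\mathsf{Ber}(p)}U(a,y)$ for every $p\in[0,1]$. The swap regret of $r:[0,1]\to A$ is $\mathsf{SR}_Z(r,\mathcal D)=\sup_{\sigma:A\to A}\mathbb E_{(p,y)\sim\mathcal D}[U(\sigma(r(p)),y)-U(r(p),y)]$. **Theorem.** For every constant $c>0$ there is a constant $C>0$, depending only on $c$, such that the following holds. Let $T\ge1$, let $(p_1,y_1),\dots,(p_T,y_T)\in[0,1]\times\{0,1\}$ be arbitrary, and let $\mathcal D$ be the uniform distribution over these pairs. Let $m\in\{2^1,2^2,\dots\}$ satisfy $\mathsf{SCDL}(\mathcal D)<2/m$, and let $\delta\in(0,1/(2m))$ satisfy $$\frac1m\ \ge\ c\,\sqrt{\frac{\log(1/\delta)}{T}}.$$ Draw $p_t'\sim\tau_m(p_t)$ independently for $t=1,\dots,T$, and let $\mathcal D'$ be the uniform distribution over $(p_1',y_1),\dots,(p_T',y_T)$. Then with probability at least $1-\delta$, $$\sup_Z\mathsf{SR}_Z(r_Z^*,\mathcal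 D')\ \le\ 2\,\mathsf{SCDL}(\mathcal D)+\frac2m+C\sqrt{\frac{\log(1/\delta)}{T}}\,\log m,$$ where the supremum is over all decision tasks $Z$ for which a best-response function exists, and over all its best-response functions $r_Z^*$. -/

import Mathlib

open scoped ENNReal

namespace SoftBinned

noncomputable section

/-- A prediction-outcome pair `(p, y) ∈ [0,1] × {0,1}`. -/
abbrev Pair : Type := unitInterval × Fin 2

/-- The expectation of `f` under a (discrete) probability distribution `D`. -/
def expect {X : Type*} (D : PMF X) (f : X → ℝ) : ℝ := ∑' x, (D x).toReal * f x

/-- The uniform distribution over the pairs `(p 0, y 0), …, (p (T-1), y (T-1))`. -/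
def empirical {T : ℕ} [NeZero T] (p : Fin T → unitInterval) (y : Fin T → Fin 2) : PMF Pair :=
  (PMF.uniformOfFintype (Fin T)).map fun t => (p t, y t)

/-! ### Randomized rounding to the grid `{0, 1/m, …, 1}` -/

/-- The largest multiple of `1/m` that is at most `p`. -/
def gridBelow (m : ℕ) (p : unitInterval) : unitInterval :=
  ⟨(⌊(m : ℝ) * p⌋₊ : ℝ) / m, by positivity, by
    refine div_le_one_of_le₀ ?_ (Nat.cast_nonneg m)
    exact (Nat.floor_le (mul_nonneg (Nat.cast_nonneg m) p.2.1)).trans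
      (mul_le_of_le_one_right (Nat.cast_nonneg m) p.2.2)⟩

/-- The smallest multiple of `1/m` that is at least `p`. -/
def gridAbove (m : ℕ) (p : unitInterval) : unitInterval :=
  ⟨(⌈(m : ℝ) * p⌉₊ : ℝ) / m, by positivity, by
    refine div_le_one_of_le₀ ?_ (Nat.cast_nonneg m)
    exact_mod_cast Nat.ceil_le.2 (mul_le_of_le_one_right (Nat.cast_nonneg m) p.2.2)⟩

/-- A coin that shows `true` with probability equal to the fractional part of `x`. -/
def fractCoin (x : ℝ) : PMF Bool :=
  PMF.ofFintype
    (fun b => if b = true then ENNReal.ofReal (Int.fract x) else ENNReal.ofReal (1 - Int.fract x))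
    (by
      have h0 := Int.fract_nonneg x
      have h1 := (Int.fract_lt_one x).le
      rw [Fintype.sum_bool, if_pos rfl, if_neg (by decide),
        ← ENNReal.ofReal_add h0 (sub_nonneg.2 h1)]
      simp)

/-- The randomized rounding `τ_m(p)`: round `p` up to the next multiple of `1/m` with probability
`m p - ⌊m p⌋`, and down otherwise. This is the choice for which the mean is `p`. -/
def tau (m : ℕ) (p : unitInterval) : PMF unitInterval :=
  (fractCoin ((m : ℝ) * p)).map fun b => if b = true then gridAbove m p else gridBelow m p

/-- The distribution `D_m` of `(p', y)`, where `(p, y) ∼ D` and `p' ∼ τ_m(p)`. -/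
def roundedDist (m : ℕ) (D : PMF Pair) : PMF Pair :=
  D.bind fun x => (tau m x.1).map fun p' => (p', x.2)

/-! ### Soft-binned calibration decision loss -/

/-- `π_i = Pr[p' = i/m]` for `(p', y) ∼ D_m`. -/
def binWeight (m : ℕ) (D : PMF Pair) (i : ℕ) : ℝ :=
  expect (roundedDist m D) fun x => if (x.1 : ℝ) = (i : ℝ) / m then 1 else 0

/-- `q_i = 𝔼[y | p' = i/m]` for `(p', y) ∼ D_m`; its value at a bin of weight `0` is irrelevant,
since `q_i` is only used after multiplication by `π_i`. -/
def binMean (m : ℕ) (D : PMF Pair) (i : ℕ) : ℝ :=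
  (expect (roundedDist m D) fun x =>
    if (x.1 : ℝ) = (i : ℝ) / m then ((x.2 : ℕ) : ℝ) else 0) / binWeight m D i

/-- `∑_{j ≤ i} π_j (q_j - (i+1)/m)_+ + ∑_{i < j ≤ m} π_j (i/m - q_j)_+`. -/
def scfdl (m : ℕ) (D : PMF Pair) (i : ℕ) : ℝ :=
  ∑ j ∈ Finset.Icc 0 i, binWeight m D j * max (binMean m D j - ((i : ℝ) + 1) / m) 0
    + ∑ j ∈ Finset.Icc (i + 1) m, binWeight m D j * max ((i : ℝ) / m - binMean m D j) 0

/-- The `m`-soft-binned calibration decision loss `SCDL_m(D)`, a maximum over `i = 0, …, m`. -/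
def scdlBins (m : ℕ) (D : PMF Pair) : ℝ :=
  (Finset.Icc 0 m).sup' ⟨0, by simp⟩ (scfdl m D)

/-- The soft-binned calibration decision loss
`SCDL(D) = inf_{m ∈ {2^1, 2^2, …}} max {SCDL_m(D), 1/m}`. -/
def scdl (D : PMF Pair) : ℝ :=
  ⨅ k : ℕ, max (scdlBins (2 ^ (k + 1)) D) (1 / (2 : ℝ) ^ (k + 1))

/-! ### Decision tasks and swap regret -/

/-- A decision task `Z = (A, U)`: an arbitrary action space `A` and a utility function
`U : A × {0,1} → [0,1]`. -/
structure DecisionTask.{u} where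
  /-- the action space -/
  A : Type u
  /-- the utility function -/
  U : A → Fin 2 → ℝ
  /-- utilities lie in `[0,1]` -/
  bounded : ∀ a y, U a y ∈ Set.Icc (0 : ℝ) 1

namespace DecisionTask

universe u

/-- The expected utility `𝔼_{y ∼ Ber(p)} U(a, y)`. -/
def expectedUtility (Z : DecisionTask.{u}) (p : unitInterval) (a : Z.A) : ℝ :=
  (p : ℝ) * Z.U a 1 + (1 - (p : ℝ)) * Z.U a 0

/-- `r` is a best-response function: `r(p) ∈ argmax_a 𝔼_{y ∼ Ber(p)} U(a, y)` for every `p`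
(ties may be broken arbitrarily). -/
def IsBestResponse (Z : DecisionTask.{u}) (r : unitInterval → Z.A) : Prop :=
  ∀ p a, Z.expectedUtility p a ≤ Z.expectedUtility p (r p)

/-- The swap regret `SR_Z(r, D) = sup_{σ : A → A} 𝔼_{(p,y) ∼ D} [U(σ(r(p)), y) - U(r(p), y)]`. -/
def swapRegret (Z : DecisionTask.{u}) (r : unitInterval → Z.A) (D : PMF Pair) : ℝ :=
  ⨆ σ : Z.A → Z.A, expect D fun x => Z.U (σ (r x.1)) x.2 - Z.U (r x.1) x.2

end DecisionTask

universe u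

/-- The set of all swap regrets `SR_Z(r_Z^*, D)` of a best response, over all decision tasks `Z`. -/
def bestResponseRegrets (D : PMF Pair) : Set ℝ :=
  {s | ∃ (Z : DecisionTask.{u}) (r : unitInterval → Z.A),
    Z.IsBestResponse r ∧ s = Z.swapRegret r D}

/-- The calibration decision loss `CDL(D) = sup_Z SR_Z(r_Z^*, D)`, over all decision tasks. -/
def cdl (D : PMF Pair) : ℝ := sSup (bestResponseRegrets.{u} D)

/-! The suprema above are suprema of non-empty bounded sets. -/

theorem expect_le_one {X : Type*} (D : PMF X) (f : X → ℝ) (hf : ∀ x, f x ≤ 1)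
    (hf' : ∀ x, -1 ≤ f x) : expect D f ≤ 1 := by
  have hs : Summable fun x => (D x).toReal := ENNReal.summable_toReal (by simp [D.tsum_coe])
  have h1 : ∑' x, (D x).toReal = 1 := by
    rw [← ENNReal.tsum_toReal_eq (fun x => D.apply_ne_top x), D.tsum_coe]; simp
  have hs' : Summable fun x => (D x).toReal * f x := by
    refine Summable.of_norm_bounded hs fun x => ?_
    rw [norm_mul, Real.norm_of_nonneg ENNReal.toReal_nonneg]
    exact mul_le_of_le_one_right ENNReal.toReal_nonneg (abs_le.2 ⟨hf' x, hf x⟩)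
  calc expect D f ≤ ∑' x, (D x).toReal :=
        hs'.tsum_le_tsum (fun x => mul_le_of_le_one_right ENNReal.toReal_nonneg (hf x)) hs
    _ = 1 := h1

theorem swapRegret_term_le (Z : DecisionTask.{u}) (r : unitInterval → Z.A) (D : PMF Pair)
    (σ : Z.A → Z.A) : (expect D fun x => Z.U (σ (r x.1)) x.2 - Z.U (r x.1) x.2) ≤ 1 := by
  refine expect_le_one D _ (fun x => ?_) (fun x => ?_) <;>
  · have h1 := Z.bounded (σ (r x.1)) x.2
    have h2 := Z.bounded (r x.1) x.2
    linarith [h1.1, h1.2, h2.1, h2.2]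

theorem bddAbove_swapRegret (Z : DecisionTask.{u}) (r : unitInterval → Z.A) (D : PMF Pair) :
    BddAbove (Set.range fun σ : Z.A → Z.A =>
      expect D fun x => Z.U (σ (r x.1)) x.2 - Z.U (r x.1) x.2) :=
  ⟨1, by rintro _ ⟨σ, rfl⟩; exact swapRegret_term_le Z r D σ⟩

theorem bddAbove_bestResponseRegrets (D : PMF Pair) : BddAbove (bestResponseRegrets.{u} D) := by
  refine ⟨1, ?_⟩
  rintro _ ⟨Z, r, -, rfl⟩
  have : Nonempty (Z.A → Z.A) := ⟨id⟩
  exact ciSup_le fun σ => swapRegret_term_le Z r D σ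

theorem bestResponseRegrets_nonempty (D : PMF Pair) : (bestResponseRegrets.{u} D).Nonempty :=
  ⟨_, ⟨PUnit, fun _ _ => 0, by simp⟩, fun _ => PUnit.unit, fun _ _ => le_rfl, rfl⟩

end

end SoftBinned

open SoftBinned MeasureTheory ProbabilityTheory

universe u v

/-!
Writing `ε = √(log (1/δ) / T)`, the proof reduces the calibration decision loss to finitely many
threshold losses on the grid and compares those of the rounded sample with those of its mean.

*Reduction to thresholds.* A best response to the prediction `j/m` has a utility line tangent to a
convex function with slopes in `[-1, 1]`, so the gain of a swap is a Bregman divergence. Telescoping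
along the grid (`affine_sub_tangent_le_right`, `affine_sub_tangent_le_left`) writes it as a
combination of one-sided losses at the threshold cells `[i/m, (i+1)/m]`, with total mass the total
increase of the slope, at most `2`; the crossing of consecutive tangents within a cell costs one
more grid step. Hence (`cdl_empirical_le`) the loss of a sample on the grid is at most
`2 * (max_i gridLoss i + 1/m)`.

*Choice of the scale.* The weights `hat (m * p - j)` of the randomized rounding interpolate
piecewise affine functions, so rounding to a grid is rounding to a finer grid followed by rounding
to the coarser one. By convexity the loss at a coarse threshold is at most the average of the losses
at the fine thresholds inside it (`mul_gridLoss_le_sum`). Scales coarser than `m` cannot compete in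
the infimum defining `scdl`, because there `1/2^k ≥ 2/m`. So `gridLoss` at scale `m` is at most
`scdl` (`gridLoss_le_scdl`).

*Concentration.* The mass in bin `j` has variance at most its weight `P j` over `T`, so with high
probability it deviates by at most `l * P j + 3 * ε ^ 2 / l` for a rate `l ≤ 1` that may depend on
the bin and the threshold (`measure_binMass_ge_le`). Summing square-root deviations over the `m`
bins directly would lose a factor `√m`. Instead `l` is taken proportional to `ε * k`, where `k` is
the distance of the bin to the threshold in grid steps. The second terms then sum to `ε` times a
harmonic number. For the first terms, `P j * k / m` is controlled in one of two ways
(`weight_mul_dist_le`): if the mean of the bin is well below the threshold, the deviation is absorbed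
by this slack; otherwise the bin is miscalibrated also with respect to the thresholds between it and
the given one, so that it is paid for by the losses there, all less than `2/m`, with harmonic
weights. This is where the factor `log m` comes from (`gridLoss_perturb_le`).
-/

namespace SoftBinned

/-! ### Hat functions -/

/-- The hat function `x ↦ (1 - |x|)₊`. The probability that `p` is rounded to `j / m` is
`hat (m * p - j)`. -/
def hat (x : ℝ) : ℝ := max (1 - |x|) 0

theorem hat_nonneg (x : ℝ) : 0 ≤ hat x := le_max_right _ _

theorem hat_le_one (x : ℝ) : hat x ≤ 1 :=
  max_le (by linarith [abs_nonneg x]) zero_le_one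

theorem hat_of_one_le {x : ℝ} (h : 1 ≤ x) : hat x = 0 := by
  rw [hat, abs_of_nonneg (by linarith), max_eq_right (by linarith)]

theorem hat_of_le_neg_one {x : ℝ} (h : x ≤ -1) : hat x = 0 := by
  rw [hat, abs_of_nonpos (by linarith), max_eq_right (by linarith)]

theorem hat_of_nonneg {x : ℝ} (h : 0 ≤ x) (h' : x ≤ 1) : hat x = 1 - x := by
  rw [hat, abs_of_nonneg h, max_eq_left (by linarith)]

theorem hat_of_nonpos {x : ℝ} (h : x ≤ 0) (h' : -1 ≤ x) : hat x = 1 + x := by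
  rw [hat, abs_of_nonpos h, max_eq_left (by linarith)]
  ring

theorem sum_hat (i : ℕ) {z : ℝ} (hz : 0 ≤ z) :
    ∑ j ∈ Finset.Icc 0 i, hat (z - j) = min 1 (max 0 (i + 1 - z)) := by
  induction i with
  | zero =>
    simp only [Finset.Icc_self, Finset.sum_singleton, Nat.cast_zero, sub_zero, zero_add]
    rw [hat, abs_of_nonneg hz, max_comm, min_eq_right (max_le zero_le_one (by linarith))]
  | succ i ih =>
    rw [Finset.sum_Icc_succ_top (by omega), ih]
    push_cast
    rcases le_total z i with h | h
    · rw [hat_of_le_neg_one (by linarith), max_eq_right (by linarith), max_eq_right (by linarith),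
        min_eq_left (by linarith), min_eq_left (by linarith)]
      ring
    · rcases le_total z (i + 1) with h1 | h1
      · rw [hat_of_nonpos (by linarith) (by linarith), max_eq_right (by linarith),
          max_eq_right (by linarith), min_eq_right (by linarith), min_eq_left (by linarith)]
        ring
      · rw [max_eq_left (by linarith : (i : ℝ) + 1 - z ≤ 0), min_eq_right zero_le_one, zero_add]
        rcases le_total z (i + 2) with h2 | h2
        · rw [hat_of_nonneg (by linarith) (by linarith), max_eq_right (by linarith),
            min_eq_right (by linarith)]
          ring
        · rw [hat_of_one_le (by linarith), max_eq_left (by linarith), min_eq_right zero_le_one]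

theorem sum_mul_hat_of_le (g : ℕ → ℝ) (M : ℕ) {x : ℝ} (hx : (M : ℝ) ≤ x) :
    ∑ j ∈ Finset.Icc 0 M, g j * hat (x - j) = g M * hat (x - M) := by
  refine Finset.sum_eq_single M (fun j hj hne => ?_) (by simp)
  have h1 : j + 1 ≤ M := by
    have := (Finset.mem_Icc.1 hj).2
    omega
  have h2 : (j : ℝ) + 1 ≤ M := by exact_mod_cast h1
  rw [hat_of_one_le (by linarith), mul_zero]

/-- The hats interpolate exactly every function that is affine between consecutive integers. -/
theorem sum_mul_hat (g : ℝ → ℝ)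
    (hg : ∀ (n : ℕ) (t : ℝ), 0 ≤ t → t ≤ 1 → g (n + t) = (1 - t) * g n + t * g (n + 1))
    (M : ℕ) {x : ℝ} (hx : 0 ≤ x) (hxM : x ≤ M) :
    ∑ j ∈ Finset.Icc 0 M, g j * hat (x - j) = g x := by
  induction M with
  | zero =>
    have : x = 0 := le_antisymm (by simpa using hxM) hx
    simp [this, hat]
  | succ M ih =>
    rw [Finset.sum_Icc_succ_top (by omega)]
    push_cast at hxM ⊢
    rcases le_total x M with h | h
    · rw [ih h, hat_of_le_neg_one (by linarith)]
      ring
    · rw [sum_mul_hat_of_le (fun j => g j) M h, hat_of_nonneg (by linarith) (by linarith),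
        hat_of_nonpos (by linarith) (by linarith)]
      have := hg M (x - M) (by linarith) (by linarith)
      rw [show (M : ℝ) + (x - M) = x by ring] at this
      rw [this]
      ring

/-- A hat of integer half-width `R` is affine between consecutive integers. -/
theorem hat_div_affine (R j n : ℕ) (hR : 0 < R) (t : ℝ) (h0 : 0 ≤ t) (h1 : t ≤ 1) :
    hat ((n + t) / R - j) = (1 - t) * hat (n / R - j) + t * hat ((n + 1) / R - j) := by
  have hR' : (0 : ℝ) < R := by exact_mod_cast hR
  have hle : (n : ℝ) / R ≤ (n + t) / R := by gcongr; linarith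
  have hle' : (n + t) / R ≤ ((n : ℝ) + 1) / R := by gcongr
  rcases le_or_gt (R * (j + 1)) n with h | h
  · have h' : (j : ℝ) + 1 ≤ n / R := by
      rw [le_div_iff₀ hR', mul_comm]
      exact_mod_cast h
    rw [hat_of_one_le (by linarith), hat_of_one_le (by linarith), hat_of_one_le (by linarith)]
    ring
  have hu : ((n : ℝ) + 1) / R ≤ j + 1 := by
    rw [div_le_iff₀ hR', mul_comm]
    exact_mod_cast h
  rcases le_or_gt (R * j) n with h' | h'
  · have hl : (j : ℝ) ≤ n / R := by
      rw [le_div_iff₀ hR', mul_comm]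
      exact_mod_cast h'
    rw [hat_of_nonneg (by linarith) (by linarith), hat_of_nonneg (by linarith) (by linarith),
      hat_of_nonneg (by linarith) (by linarith)]
    ring
  have hv : ((n : ℝ) + 1) / R ≤ j := by
    rw [div_le_iff₀ hR', mul_comm]
    exact_mod_cast h'
  rcases le_or_gt (R * j) (n + R) with h2 | h2
  · have hl : (j : ℝ) - 1 ≤ n / R := by
      rw [le_div_iff₀ hR']
      have : (R * j : ℝ) ≤ n + R := by exact_mod_cast h2
      linarith
    rw [hat_of_nonpos (by linarith) (by linarith), hat_of_nonpos (by linarith) (by linarith),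
      hat_of_nonpos (by linarith) (by linarith)]
    ring
  · have hl : ((n : ℝ) + 1) / R ≤ j - 1 := by
      rw [div_le_iff₀ hR']
      have : ((n + R + 1 : ℕ) : ℝ) ≤ (R * j : ℕ) := by exact_mod_cast h2
      push_cast at this
      linarith
    rw [hat_of_le_neg_one (by linarith), hat_of_le_neg_one (by linarith),
      hat_of_le_neg_one (by linarith)]
    ring

/-- Rounding to the finer grid and then to the coarser one is the same as rounding directly. -/
theorem sum_hat_mul_hat (R j M : ℕ) (hR : 0 < R) {x : ℝ} (hx : 0 ≤ x) (hxM : x ≤ M) :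
    ∑ l ∈ Finset.Icc 0 M, hat ((l : ℝ) / R - j) * hat (x - l) = hat (x / R - j) :=
  sum_mul_hat (fun x => hat (x / R - j)) (fun n t h0 h1 => hat_div_affine R j n hR t h0 h1)
    M hx hxM

/-! ### The threshold losses of a binned distribution and their monotonicity under refinement -/

/-- The loss at the threshold cell `[i/m, (i+1)/m]` of a binned distribution on the grid
`{0, 1/m, …, 1}`, where bin `j` has weight `P j` and outcome mass `Q j`, its weight times its
conditional mean. -/
noncomputable def gridLoss (m : ℕ) (P Q : ℕ → ℝ) (i : ℕ) : ℝ :=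
  ∑ j ∈ Finset.Icc 0 i, max (Q j - ((i : ℝ) + 1) / m * P j) 0
    + ∑ j ∈ Finset.Icc (i + 1) m, max ((i : ℝ) / m * P j - Q j) 0

theorem max_sum_le {ι : Type*} (s : Finset ι) (f : ι → ℝ) :
    max (∑ l ∈ s, f l) 0 ≤ ∑ l ∈ s, max (f l) 0 :=
  max_le (Finset.sum_le_sum fun _ _ => le_max_left _ _)
    (Finset.sum_nonneg fun _ _ => le_max_right _ _)

theorem sum_ite_le (n R : ℕ) :
    ∑ r ∈ Finset.range R, (if n ≤ r then (1 : ℝ) else 0) = ((R - n : ℕ) : ℝ) := by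
  rw [Finset.sum_boole]
  congr 1
  induction R with
  | zero => simp
  | succ R ih =>
    rw [Finset.range_add_one, Finset.filter_insert]
    split_ifs with h
    · rw [Finset.card_insert_of_notMem (by simp), ih]
      omega
    · rw [ih]
      omega

theorem mul_clamp_eq_sum (R i l : ℕ) (hR : 0 < R) :
    (R : ℝ) * min 1 (max 0 ((i : ℝ) + 1 - l / R))
      = ∑ r ∈ Finset.range R, (if l ≤ i * R + r then (1 : ℝ) else 0) := by
  have hR' : (0 : ℝ) < R := by exact_mod_cast hR
  have h1 : ∀ r, (l ≤ i * R + r) = (l - i * R ≤ r) := fun r => by simp; omega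
  simp_rw [h1]
  rw [sum_ite_le]
  have hdiv : (l : ℝ) / R * R = l := div_mul_cancel₀ _ hR'.ne'
  rcases le_total l (i * R) with h | h
  · have h2 : (l : ℝ) / R ≤ i := by
      rw [div_le_iff₀ hR']
      exact_mod_cast h
    rw [Nat.sub_eq_zero_of_le h, max_eq_right (by linarith), min_eq_left (by linarith)]
    simp
  have h2 : (i : ℝ) ≤ (l : ℝ) / R := by
    rw [le_div_iff₀ hR']
    exact_mod_cast h
  rcases le_total l (i * R + R) with h' | h'
  · have h3 : (l : ℝ) / R ≤ i + 1 := by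
      rw [div_le_iff₀ hR', add_mul, one_mul]
      exact_mod_cast h'
    rw [max_eq_right (by linarith), min_eq_right (by linarith), Nat.cast_sub (by omega),
      Nat.cast_sub h]
    push_cast
    linarith
  · have h3 : (i : ℝ) + 1 ≤ (l : ℝ) / R := by
      rw [le_div_iff₀ hR', add_mul, one_mul]
      exact_mod_cast h'
    rw [max_eq_left (by linarith), min_eq_right zero_le_one, mul_zero,
      Nat.sub_eq_zero_of_le (by omega)]
    simp

theorem sum_Icc_eq_sum_ite (M i : ℕ) (hi : i ≤ M) (f : ℕ → ℝ) :
    ∑ l ∈ Finset.Icc 0 i, f l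
      = ∑ l ∈ Finset.Icc 0 M, (if l ≤ i then (1 : ℝ) else 0) * f l := by
  simp_rw [ite_mul, one_mul, zero_mul]
  rw [← Finset.sum_filter]
  congr 1
  ext l
  simp
  omega

theorem sum_Icc_succ_eq_sum_ite (M i : ℕ) (f : ℕ → ℝ) :
    ∑ l ∈ Finset.Icc (i + 1) M, f l
      = ∑ l ∈ Finset.Icc 0 M, (1 - if l ≤ i then (1 : ℝ) else 0) * f l := by
  have : ∀ l, (1 - if l ≤ i then (1 : ℝ) else 0) * f l = if i + 1 ≤ l then f l else 0 := fun l => by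
    rcases le_or_gt l i with h | h
    · rw [if_pos h, if_neg (by omega)]
      ring
    · rw [if_neg (by omega), if_pos (by omega)]
      ring
  simp_rw [this]
  rw [← Finset.sum_filter]
  congr 1
  ext l
  simp
  omega

/-- The loss of the coarser binning is at most the average, over the fine threshold cells inside
a coarse one, of the losses of the finer binning. -/
theorem mul_gridLoss_le_sum {m R i : ℕ} (hR : 0 < R) (hi : i < m)
    {P Q P' Q' : ℕ → ℝ} (hP' : ∀ l, 0 ≤ P' l)
    (hP : ∀ j, P j = ∑ l ∈ Finset.Icc 0 (m * R), hat ((l : ℝ) / R - j) * P' l)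
    (hQ : ∀ j, Q j = ∑ l ∈ Finset.Icc 0 (m * R), hat ((l : ℝ) / R - j) * Q' l) :
    R * gridLoss m P Q i ≤ ∑ r ∈ Finset.range R, gridLoss (m * R) P' Q' (i * R + r) := by
  have hR' : (0 : ℝ) < R := by exact_mod_cast hR
  have hm' : (0 : ℝ) < m := by exact_mod_cast (by omega : 0 < m)
  set M := m * R with hM
  -- `W l` is the probability that `l / M` is rounded to one of the coarse bins `0, …, i`.
  set W : ℕ → ℝ := fun l => min 1 (max 0 ((i : ℝ) + 1 - l / R)) with hW
  have hWl : ∀ l : ℕ, ∑ j ∈ Finset.Icc 0 i, hat ((l : ℝ) / R - j) = W l := fun l =>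
    sum_hat i (by positivity)
  have hWr : ∀ l ∈ Finset.Icc 0 M, ∑ j ∈ Finset.Icc (i + 1) m, hat ((l : ℝ) / R - j) = 1 - W l := by
    intro l hl
    have h1 : ∑ j ∈ Finset.Icc 0 m, hat ((l : ℝ) / R - j) = 1 := by
      rw [sum_hat m (by positivity)]
      have : (l : ℝ) / R ≤ m := by
        rw [div_le_iff₀ hR']
        exact_mod_cast (Finset.mem_Icc.1 hl).2
      rw [max_eq_right (by linarith), min_eq_left (by linarith)]
    have h2 := sum_Icc_succ_eq_sum_ite m i (fun j => hat ((l : ℝ) / R - j))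
    have h3 := sum_Icc_eq_sum_ite m i hi.le (fun j => hat ((l : ℝ) / R - j))
    simp_rw [sub_mul, one_mul, Finset.sum_sub_distrib] at h2
    rw [h2, ← h3, h1, hWl]
  have hleft : ∑ j ∈ Finset.Icc 0 i, max (Q j - ((i : ℝ) + 1) / m * P j) 0
      ≤ ∑ l ∈ Finset.Icc 0 M, W l * max (Q' l - ((i : ℝ) + 1) / m * P' l) 0 := by
    calc _ ≤ ∑ j ∈ Finset.Icc 0 i, ∑ l ∈ Finset.Icc 0 M,
          hat ((l : ℝ) / R - j) * max (Q' l - ((i : ℝ) + 1) / m * P' l) 0 := by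
          refine Finset.sum_le_sum fun j _ => ?_
          rw [hP, hQ, Finset.mul_sum, ← Finset.sum_sub_distrib]
          refine (max_sum_le _ _).trans (Finset.sum_le_sum fun l _ => le_of_eq ?_)
          rw [mul_max_of_nonneg _ _ (hat_nonneg _), mul_zero]
          congr 1
          ring
      _ = _ := by
          rw [Finset.sum_comm]
          simp_rw [← Finset.sum_mul, hWl]
  have hright : ∑ j ∈ Finset.Icc (i + 1) m, max ((i : ℝ) / m * P j - Q j) 0
      ≤ ∑ l ∈ Finset.Icc 0 M, (1 - W l) * max ((i : ℝ) / m * P' l - Q' l) 0 := by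
    calc _ ≤ ∑ j ∈ Finset.Icc (i + 1) m, ∑ l ∈ Finset.Icc 0 M,
          hat ((l : ℝ) / R - j) * max ((i : ℝ) / m * P' l - Q' l) 0 := by
          refine Finset.sum_le_sum fun j _ => ?_
          rw [hP, hQ, Finset.mul_sum, ← Finset.sum_sub_distrib]
          refine (max_sum_le _ _).trans (Finset.sum_le_sum fun l _ => le_of_eq ?_)
          rw [mul_max_of_nonneg _ _ (hat_nonneg _), mul_zero]
          congr 1
          ring
      _ = _ := by
          rw [Finset.sum_comm]
          simp_rw [← Finset.sum_mul]
          exact Finset.sum_congr rfl fun l hl => by rw [hWr l hl]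
  have hfine : ∀ r ∈ Finset.range R,
      ∑ l ∈ Finset.Icc 0 M, (if l ≤ i * R + r then (1 : ℝ) else 0)
          * max (Q' l - ((i : ℝ) + 1) / m * P' l) 0
        + ∑ l ∈ Finset.Icc 0 M, (1 - if l ≤ i * R + r then (1 : ℝ) else 0)
          * max ((i : ℝ) / m * P' l - Q' l) 0 ≤ gridLoss M P' Q' (i * R + r) := by
    intro r hr
    have hrR := Finset.mem_range.1 hr
    have hrR' : (r : ℝ) + 1 ≤ R := by exact_mod_cast hrR
    have hle : i * R + r ≤ M := by
      have : (i + 1) * R ≤ m * R := Nat.mul_le_mul_right _ hi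
      rw [add_mul] at this
      omega
    rw [← sum_Icc_eq_sum_ite M _ hle, ← sum_Icc_succ_eq_sum_ite, gridLoss]
    refine add_le_add (Finset.sum_le_sum fun l _ => max_le_max ?_ le_rfl)
      (Finset.sum_le_sum fun l _ => max_le_max ?_ le_rfl)
    · have : (((i * R + r : ℕ) : ℝ) + 1) / (M : ℕ) ≤ ((i : ℝ) + 1) / m := by
        rw [hM]
        push_cast
        rw [div_le_div_iff₀ (by positivity) hm']
        nlinarith
      nlinarith [hP' l, mul_le_mul_of_nonneg_right this (hP' l)]
    · have : (i : ℝ) / m ≤ ((i * R + r : ℕ) : ℝ) / (M : ℕ) := by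
        rw [hM]
        push_cast
        rw [div_le_div_iff₀ hm' (by positivity)]
        nlinarith [mul_nonneg (Nat.cast_nonneg (α := ℝ) r) hm'.le]
      nlinarith [hP' l, mul_le_mul_of_nonneg_right this (hP' l)]
  calc R * gridLoss m P Q i
      ≤ R * (∑ l ∈ Finset.Icc 0 M, W l * max (Q' l - ((i : ℝ) + 1) / m * P' l) 0
        + ∑ l ∈ Finset.Icc 0 M, (1 - W l) * max ((i : ℝ) / m * P' l - Q' l) 0) := by
        rw [gridLoss]
        gcongr
    _ = ∑ r ∈ Finset.range R, (∑ l ∈ Finset.Icc 0 M, (if l ≤ i * R + r then (1 : ℝ) else 0)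
          * max (Q' l - ((i : ℝ) + 1) / m * P' l) 0
        + ∑ l ∈ Finset.Icc 0 M, (1 - if l ≤ i * R + r then (1 : ℝ) else 0)
          * max ((i : ℝ) / m * P' l - Q' l) 0) := by
        rw [mul_add, Finset.mul_sum, Finset.mul_sum, Finset.sum_add_distrib, Finset.sum_comm,
          Finset.sum_comm (s := Finset.range R)]
        congr 1
        · refine Finset.sum_congr rfl fun l _ => ?_
          rw [← Finset.sum_mul, ← mul_clamp_eq_sum R i l hR, mul_assoc]
        · refine Finset.sum_congr rfl fun l _ => ?_
          rw [← Finset.sum_mul, Finset.sum_sub_distrib, ← mul_clamp_eq_sum R i l hR]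
          simp [hW]
          ring
    _ ≤ _ := Finset.sum_le_sum hfine

theorem gridLoss_le_of_refine {m R : ℕ} (hR : 0 < R) {P Q P' Q' : ℕ → ℝ} (hP' : ∀ l, 0 ≤ P' l)
    (hP : ∀ j, P j = ∑ l ∈ Finset.Icc 0 (m * R), hat ((l : ℝ) / R - j) * P' l)
    (hQ : ∀ j, Q j = ∑ l ∈ Finset.Icc 0 (m * R), hat ((l : ℝ) / R - j) * Q' l)
    {B : ℝ} (hB : ∀ i ≤ m * R, gridLoss (m * R) P' Q' i ≤ B) {i : ℕ} (hi : i < m) :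
    gridLoss m P Q i ≤ B := by
  have hR' : (0 : ℝ) < R := by exact_mod_cast hR
  refine le_of_mul_le_mul_left ((mul_gridLoss_le_sum hR hi hP' hP hQ).trans ?_) hR'
  calc _ ≤ ∑ r ∈ Finset.range R, B := Finset.sum_le_sum fun r hr => hB _ ?_
    _ = R * B := by simp
  have := Finset.mem_range.1 hr
  have h : (i + 1) * R ≤ m * R := Nat.mul_le_mul_right _ hi
  rw [add_mul] at h
  omega

/-! ### Perturbation of the threshold losses -/

theorem sum_inv_le_harmonic {n m : ℕ} (h : n ≤ m) :
    ∑ k ∈ Finset.Icc 1 n, (1 : ℝ) / k ≤ harmonic m := by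
  rw [harmonic_eq_sum_Icc]
  push_cast
  simp_rw [one_div]
  exact Finset.sum_le_sum_of_subset_of_nonneg (Finset.Icc_subset_Icc_right h)
    fun _ _ _ => by positivity

/-- Let a bin of weight `π` at distance `k` (in units of `h`) from a threshold have signed excess
`a` over it. If the outcome mean is far below the threshold, then `-a` is of order `π * k * h`;
otherwise the bin contributes to the losses at the thresholds which are `d` units closer to it,
and the harmonically weighted sum of these contributions is of order `π * k * h`. -/
theorem weight_mul_dist_le {a π h : ℝ} {k : ℕ} (hk : 1 ≤ k) (hπ : 0 ≤ π) (hπ1 : π ≤ 1)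
    (hh : 0 ≤ h) :
    π * k * h ≤ 6 * ∑ d ∈ Finset.Icc 1 (k - 1), 1 / (d : ℝ) * max (a + d * h * π) 0
      + 4 * max (-a) 0 + h * (1 / k) := by
  have hF : ∀ s : Finset ℕ, 0 ≤ ∑ d ∈ s, 1 / (d : ℝ) * max (a + d * h * π) 0 := fun s =>
    Finset.sum_nonneg fun d _ => mul_nonneg (by positivity) (le_max_right _ _)
  have hF1 := hF (Finset.Icc 1 (k - 1))
  have hneg : -a ≤ max (-a) 0 := le_max_left _ _
  have hneg0 : 0 ≤ max (-a) 0 := le_max_right _ _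
  have hlast : 0 ≤ h * (1 / (k : ℝ)) := by positivity
  obtain rfl | hk2 : k = 1 ∨ 2 ≤ k := by omega
  · norm_num
    nlinarith [le_max_right (-a) 0]
  rcases le_or_gt a (-(π * k * h) / 4) with ha | ha
  · linarith
  have hsub : Finset.Icc ((k + 1) / 2) (k - 1) ⊆ Finset.Icc 1 (k - 1) :=
    Finset.Icc_subset_Icc_left (by omega)
  have hsum : ((k / 2 : ℕ) : ℝ) * (π * h / 2)
      ≤ ∑ d ∈ Finset.Icc 1 (k - 1), 1 / (d : ℝ) * max (a + d * h * π) 0 := by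
    calc ((k / 2 : ℕ) : ℝ) * (π * h / 2)
        = ∑ _d ∈ Finset.Icc ((k + 1) / 2) (k - 1), π * h / 2 := by
          rw [Finset.sum_const, Nat.card_Icc, nsmul_eq_mul]
          congr 2
          omega
      _ ≤ ∑ d ∈ Finset.Icc ((k + 1) / 2) (k - 1), 1 / (d : ℝ) * max (a + d * h * π) 0 := by
          refine Finset.sum_le_sum fun d hd => ?_
          have hd1 := Finset.mem_Icc.1 hd
          have hd0 : (0 : ℝ) < d := by exact_mod_cast (by omega : 0 < d)
          have hkd : (k : ℝ) ≤ 2 * d := by exact_mod_cast (by omega : k ≤ 2 * d)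
          rw [one_div, ← div_eq_inv_mul, le_div_iff₀ hd0]
          refine le_trans ?_ (le_max_left _ _)
          nlinarith [mul_le_mul_of_nonneg_left hkd (mul_nonneg hπ hh)]
      _ ≤ _ := Finset.sum_le_sum_of_subset_of_nonneg hsub fun d _ _ =>
          mul_nonneg (by positivity) (le_max_right _ _)
  have hfloor : (k : ℝ) ≤ 3 * ((k / 2 : ℕ) : ℝ) := by
    exact_mod_cast (by omega : k ≤ 3 * (k / 2))
  nlinarith [mul_le_mul_of_nonneg_right hfloor (mul_nonneg hπ hh)]

/-- Effect of a perturbation of Bernstein size of one bin: its own slack `max (-a) 0` absorbs part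
of the perturbation, the rest is charged to the losses at nearby thresholds. -/
theorem max_perturb_le {a a' π ε c : ℝ} {k m : ℕ} (hk : 1 ≤ k) (hm : 0 < m) (hπ : 0 ≤ π)
    (hπ1 : π ≤ 1) (hε : 0 < ε) (hc : 0 < c) (hcε : c * ε ≤ 1 / m)
    (h : a' - a ≤ c / 4 * ε * k * π + 3 * ε ^ 2 / (c / 4 * ε * k)) :
    max a' 0 ≤ max a 0
      + (3 / 2 * (c * ε * m) * ∑ d ∈ Finset.Icc 1 (k - 1), 1 / (d : ℝ) * max (a + d / m * π) 0
        + (c / 4 + 12 / c) * ε * (1 / k)) := by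
  have hm' : (0 : ℝ) < m := by exact_mod_cast hm
  have hk' : (0 : ℝ) < k := by exact_mod_cast hk
  have hcm : c * ε * m ≤ 1 := by rwa [le_div_iff₀ hm'] at hcε
  have hcm0 : 0 ≤ c * ε * m := by positivity
  have key := weight_mul_dist_le (a := a) hk hπ hπ1 (h := 1 / (m : ℝ)) (by positivity)
  simp_rw [mul_one_div (_ : ℝ) (m : ℝ)] at key
  set F := ∑ d ∈ Finset.Icc 1 (k - 1), 1 / (d : ℝ) * max (a + d / m * π) 0 with hF
  have hF0 : 0 ≤ F := Finset.sum_nonneg fun d _ => mul_nonneg (by positivity) (le_max_right _ _)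
  have hscaled := mul_le_mul_of_nonneg_left key (by positivity : 0 ≤ c * ε * m / 4)
  have h1 : c * ε * m / 4 * (π * k / m) = c / 4 * ε * k * π := by field_simp
  have h2 : 3 * ε ^ 2 / (c / 4 * ε * k) = 12 / c * ε * (1 / k) := by
    field_simp
    norm_num
  have h3 : c * ε * m / 4 * (1 / (m : ℝ) * (1 / k)) = c / 4 * ε * (1 / k) := by field_simp
  have hneg0 : 0 ≤ max (-a) 0 := le_max_right _ _
  have h4 : c * ε * m * max (-a) 0 ≤ max (-a) 0 := mul_le_of_le_one_left hneg0 hcm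
  have h5 : max a 0 = a + max (-a) 0 := by
    rcases le_total a 0 with ha | ha
    · rw [max_eq_right ha, max_eq_left (by linarith)]
      ring
    · rw [max_eq_left ha, max_eq_right (by linarith)]
      ring
  have h6 : 0 ≤ 3 / 2 * (c * ε * m) * F + (c / 4 + 12 / c) * ε * (1 / k) := by positivity
  refine max_le ?_ (by linarith [le_max_right a 0])
  rw [h1, mul_add, mul_add, h3] at hscaled
  rw [h2] at h
  rw [h5]
  nlinarith

/-- If the losses at all thresholds are at most `B` and every bin is perturbed by an amount of
Bernstein size, with a rate proportional to its distance from the threshold, then the loss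
grows by at most a multiple of `ε` times a harmonic number. -/
theorem gridLoss_perturb_le {m i : ℕ} (hi : i < m) {P Q P' Q' : ℕ → ℝ} (hP : ∀ j, 0 ≤ P j)
    (hP1 : ∀ j, P j ≤ 1) {ε c B : ℝ} (hε : 0 < ε) (hc : 0 < c) (hcε : c * ε ≤ 1 / m)
    (hB : ∀ l < m, gridLoss m P Q l ≤ B)
    (hl : ∀ j ≤ i, (Q' j - ((i : ℝ) + 1) / m * P' j) - (Q j - ((i : ℝ) + 1) / m * P j)
      ≤ c / 4 * ε * (i + 1 - j : ℕ) * P j + 3 * ε ^ 2 / (c / 4 * ε * (i + 1 - j : ℕ)))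
    (hr : ∀ j, i + 1 ≤ j → j ≤ m → ((i : ℝ) / m * P' j - Q' j) - ((i : ℝ) / m * P j - Q j)
      ≤ c / 4 * ε * (j - i : ℕ) * P j + 3 * ε ^ 2 / (c / 4 * ε * (j - i : ℕ))) :
    gridLoss m P' Q' i ≤ gridLoss m P Q i
      + (3 * (c * ε * m) * B + 2 * (c / 4 + 12 / c) * ε) * harmonic m := by
  have hm : 0 < m := by omega
  have hm' : (0 : ℝ) < m := by exact_mod_cast hm
  have hleft0 : ∀ l, 0 ≤ ∑ j ∈ Finset.Icc 0 l, max (Q j - ((l : ℝ) + 1) / m * P j) 0 := fun l =>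
    Finset.sum_nonneg fun _ _ => le_max_right _ _
  have hright0 : ∀ l : ℕ, 0 ≤ ∑ j ∈ Finset.Icc (l + 1) m, max ((l : ℝ) / m * P j - Q j) 0 :=
    fun l => Finset.sum_nonneg fun _ _ => le_max_right _ _
  have hB0 : 0 ≤ B := (add_nonneg (hleft0 i) (hright0 i)).trans (hB i hi)
  have hL : ∑ j ∈ Finset.Icc 0 i, ∑ d ∈ Finset.Icc 1 (i + 1 - j - 1),
      1 / (d : ℝ) * max (Q j - ((i : ℝ) + 1) / m * P j + d / m * P j) 0 ≤ B * harmonic m := by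
    rw [Finset.sum_comm' (t' := Finset.Icc 1 i) (s' := fun d => Finset.Icc 0 (i - d))
      (fun j d => by simp only [Finset.mem_Icc]; omega)]
    refine le_trans (Finset.sum_le_sum (g := fun d : ℕ => B * (1 / (d : ℝ))) fun d hd => ?_) ?_
    · have hd' := Finset.mem_Icc.1 hd
      rw [← Finset.mul_sum, mul_comm]
      refine mul_le_mul_of_nonneg_right ?_ (by positivity)
      refine le_trans (le_of_eq ?_) ((le_add_of_nonneg_right (hright0 _)).trans
        (hB (i - d) (by omega)))
      refine Finset.sum_congr rfl fun j _ => ?_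
      rw [Nat.cast_sub hd'.2]
      congr 1
      ring
    · rw [← Finset.mul_sum]
      exact mul_le_mul_of_nonneg_left (sum_inv_le_harmonic hi.le) hB0
  have hR : ∑ j ∈ Finset.Icc (i + 1) m, ∑ d ∈ Finset.Icc 1 (j - i - 1),
      1 / (d : ℝ) * max ((i : ℝ) / m * P j - Q j + d / m * P j) 0 ≤ B * harmonic m := by
    rw [Finset.sum_comm' (t' := Finset.Icc 1 (m - i - 1)) (s' := fun d => Finset.Icc (i + d + 1) m)
      (fun j d => by simp only [Finset.mem_Icc]; omega)]
    refine le_trans (Finset.sum_le_sum (g := fun d : ℕ => B * (1 / (d : ℝ))) fun d hd => ?_) ?_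
    · have hd' := Finset.mem_Icc.1 hd
      rw [← Finset.mul_sum, mul_comm]
      refine mul_le_mul_of_nonneg_right ?_ (by positivity)
      refine le_trans (le_of_eq ?_) ((le_add_of_nonneg_left (hleft0 _)).trans
        (hB (i + d) (by omega)))
      refine Finset.sum_congr rfl fun j _ => ?_
      push_cast
      congr 1
      ring
    · rw [← Finset.mul_sum]
      exact mul_le_mul_of_nonneg_left (sum_inv_le_harmonic (by omega)) hB0
  have hKL : ∑ j ∈ Finset.Icc 0 i, (1 : ℝ) / (i + 1 - j : ℕ) ≤ harmonic m := by
    refine le_trans (le_of_eq ?_) (sum_inv_le_harmonic (n := i + 1) (by omega))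
    refine Finset.sum_nbij' (fun j => i + 1 - j) (fun k => i + 1 - k) ?_ ?_ ?_ ?_ ?_ <;>
      intro j hj <;> simp only [Finset.mem_Icc] at * <;> omega
  have hKR : ∑ j ∈ Finset.Icc (i + 1) m, (1 : ℝ) / (j - i : ℕ) ≤ harmonic m := by
    refine le_trans (le_of_eq ?_) (sum_inv_le_harmonic (n := m - i) (by omega))
    refine Finset.sum_nbij' (fun j => j - i) (fun k => i + k) ?_ ?_ ?_ ?_ ?_ <;>
      intro j hj <;> simp only [Finset.mem_Icc] at * <;> omega
  have hleft := Finset.sum_le_sum fun j (hj : j ∈ Finset.Icc 0 i) =>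
    max_perturb_le (k := i + 1 - j) (by have := (Finset.mem_Icc.1 hj).2; omega) hm (hP j) (hP1 j)
      hε hc hcε (hl j (Finset.mem_Icc.1 hj).2)
  have hright := Finset.sum_le_sum fun j (hj : j ∈ Finset.Icc (i + 1) m) =>
    max_perturb_le (k := j - i) (by have := (Finset.mem_Icc.1 hj).1; omega) hm (hP j) (hP1 j)
      hε hc hcε (hr j (Finset.mem_Icc.1 hj).1 (Finset.mem_Icc.1 hj).2)
  rw [Finset.sum_add_distrib, Finset.sum_add_distrib, ← Finset.mul_sum, ← Finset.mul_sum]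
    at hleft hright
  have hc0 : 0 ≤ 3 / 2 * (c * ε * m) := by positivity
  have hc1 : 0 ≤ (c / 4 + 12 / c) * ε := by positivity
  have e1 := mul_le_mul_of_nonneg_left hL hc0
  have e2 := mul_le_mul_of_nonneg_left hR hc0
  have e3 := mul_le_mul_of_nonneg_left hKL hc1
  have e4 := mul_le_mul_of_nonneg_left hKR hc1
  unfold gridLoss
  linarith

/-! ### Swap regret on a grid -/

/-- Telescoping bound for the Bregman divergence of the convex function `u` with tangent lines
`ℓ_j(x) = α j + g j * x` at `j / m`, at a point `q` to the right of the base point. -/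
theorem affine_sub_tangent_le_right {m : ℕ} (hm : 0 < m) {α g : ℕ → ℝ}
    (htan : ∀ i ≤ m, ∀ j ≤ m, α i + g i * (j / m) ≤ α j + g j * (j / m))
    {α₀ g₀ q : ℝ} (h₀ : ∀ j ≤ m, α₀ + g₀ * (j / m) ≤ α j + g j * (j / m)) (hq1 : q ≤ 1)
    {j : ℕ} (hj : j ≤ m) (hjq : (j : ℝ) / m ≤ q) :
    (α₀ + g₀ * q) - (α j + g j * q) ≤ ∑ l ∈ Finset.Ico j m,
      ((g (l + 1) - g l) * max (q - ((l : ℝ) + 1) / m) 0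
        + ((α (l + 1) + g (l + 1) * (((l : ℝ) + 1) / m)) - (α l + g l * (((l : ℝ) + 1) / m)))) := by
  have hm' : (0 : ℝ) < m := by exact_mod_cast hm
  have hnn : ∀ l < m, 0 ≤ (g (l + 1) - g l) * max (q - ((l : ℝ) + 1) / m) 0
        + ((α (l + 1) + g (l + 1) * (((l : ℝ) + 1) / m))
          - (α l + g l * (((l : ℝ) + 1) / m))) := by
    intro l hl
    have h1 := htan l (by omega) (l + 1) (by omega)
    have h2 := htan (l + 1) (by omega) l (by omega)
    push_cast at h1
    have h3 : ((l : ℝ) + 1) / m = l / m + 1 / m := by ring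
    have h4 : (0 : ℝ) < 1 / m := by positivity
    have h5 : 0 ≤ g (l + 1) - g l := by
      rw [h3] at h1
      by_contra hcon
      nlinarith
    have := mul_nonneg h5 (le_max_right (q - ((l : ℝ) + 1) / m) 0)
    linarith
  induction hd : m - j generalizing j with
  | zero =>
    obtain rfl : j = m := by omega
    rw [div_self hm'.ne'] at hjq
    obtain rfl : q = 1 := le_antisymm hq1 hjq
    have := h₀ j le_rfl
    rw [div_self hm'.ne'] at this
    simp
    linarith
  | succ n ih =>
    have hjm : j < m := by omega
    rw [Finset.sum_eq_sum_Ico_succ_bot hjm]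
    have hrest : 0 ≤ ∑ l ∈ Finset.Ico (j + 1) m,
      ((g (l + 1) - g l) * max (q - ((l : ℝ) + 1) / m) 0
        + ((α (l + 1) + g (l + 1) * (((l : ℝ) + 1) / m))
          - (α l + g l * (((l : ℝ) + 1) / m)))) :=
      Finset.sum_nonneg fun l hl => hnn l (Finset.mem_Ico.1 hl).2
    rcases le_total q (((j : ℝ) + 1) / m) with h | h
    · -- In the cell of the base point, affinity and the bounds at both ends suffice.
      have h1 := h₀ j hj
      have h2 := h₀ (j + 1) hjm
      push_cast at h2
      rw [max_eq_right (by linarith), mul_zero, zero_add]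
      have h3 := htan j hj (j + 1) hjm
      push_cast at h3
      have h6 : (j : ℝ) / m < ((j : ℝ) + 1) / m := by gcongr; linarith
      have key : (((j : ℝ) + 1) / m - j / m) * ((α₀ + g₀ * q) - (α j + g j * q))
          ≤ (((j : ℝ) + 1) / m - j / m) * ((α (j + 1) + g (j + 1) * (((j : ℝ) + 1) / m))
            - (α j + g j * (((j : ℝ) + 1) / m))) := by
        have a1 := mul_le_mul_of_nonneg_left h1 (sub_nonneg.2 h)
        have a2 := mul_le_mul_of_nonneg_left h2 (sub_nonneg.2 hjq)
        have a3 := mul_le_mul_of_nonneg_left h3 (sub_nonneg.2 h)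
        linarith
      have := le_of_mul_le_mul_left key (by linarith)
      linarith
    · have h1 := ih (j := j + 1) hjm (by push_cast; exact h) (by omega)
      rw [max_eq_left (by linarith)]
      linarith

/-- The counterpart of `affine_sub_tangent_le_right` for a point to the left of the base point. -/
theorem affine_sub_tangent_le_left {m : ℕ} (hm : 0 < m) {α g : ℕ → ℝ}
    (htan : ∀ i ≤ m, ∀ j ≤ m, α i + g i * (j / m) ≤ α j + g j * (j / m))
    {α₀ g₀ q : ℝ} (h₀ : ∀ j ≤ m, α₀ + g₀ * (j / m) ≤ α j + g j * (j / m)) (hq0 : 0 ≤ q)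
    {j : ℕ} (hj : j ≤ m) (hjq : q ≤ (j : ℝ) / m) :
    (α₀ + g₀ * q) - (α j + g j * q) ≤ ∑ l ∈ Finset.range j,
      ((g (l + 1) - g l) * max ((l : ℝ) / m - q) 0
        + ((α l + g l * ((l : ℝ) / m)) - (α (l + 1) + g (l + 1) * ((l : ℝ) / m)))) := by
  have hm' : (0 : ℝ) < m := by exact_mod_cast hm
  have hnn : ∀ l < m, 0 ≤ (g (l + 1) - g l) * max ((l : ℝ) / m - q) 0
        + ((α l + g l * ((l : ℝ) / m)) - (α (l + 1) + g (l + 1) * ((l : ℝ) / m))) := by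
    intro l hl
    have h1 := htan l (by omega) (l + 1) (by omega)
    have h2 := htan (l + 1) (by omega) l (by omega)
    push_cast at h1
    have h3 : ((l : ℝ) + 1) / m = l / m + 1 / m := by ring
    have h4 : (0 : ℝ) < 1 / m := by positivity
    have h5 : 0 ≤ g (l + 1) - g l := by
      rw [h3] at h1
      by_contra hcon
      nlinarith
    have := mul_nonneg h5 (le_max_right ((l : ℝ) / m - q) 0)
    linarith
  induction j with
  | zero =>
    simp only [Nat.cast_zero, zero_div] at hjq
    obtain rfl : q = 0 := le_antisymm hjq hq0
    have := h₀ 0 hj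
    simp only [Nat.cast_zero, zero_div] at this
    simp
    linarith
  | succ j ih =>
    rw [Finset.sum_range_succ]
    push_cast at hjq
    have hrest : 0 ≤ ∑ l ∈ Finset.range j,
      ((g (l + 1) - g l) * max ((l : ℝ) / m - q) 0
        + ((α l + g l * ((l : ℝ) / m)) - (α (l + 1) + g (l + 1) * ((l : ℝ) / m)))) :=
      Finset.sum_nonneg fun l hl => hnn l (by have := Finset.mem_range.1 hl; omega)
    rcases le_total q ((j : ℝ) / m) with h | h
    · have h1 := ih (by omega) h
      rw [max_eq_left (by linarith)]
      linarith
    · have h1 := h₀ j (by omega)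
      have h2 := h₀ (j + 1) hj
      push_cast at h2
      rw [max_eq_right (by linarith), mul_zero, zero_add]
      have h3 := htan (j + 1) hj j (by omega)
      have h6 : (j : ℝ) / m < ((j : ℝ) + 1) / m := by gcongr; linarith
      have key : (((j : ℝ) + 1) / m - j / m) * ((α₀ + g₀ * q) - (α (j + 1) + g (j + 1) * q))
          ≤ (((j : ℝ) + 1) / m - j / m) * ((α j + g j * ((j : ℝ) / m))
            - (α (j + 1) + g (j + 1) * ((j : ℝ) / m))) := by
        have a1 := mul_le_mul_of_nonneg_left h1 (sub_nonneg.2 hjq)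
        have a2 := mul_le_mul_of_nonneg_left h2 (sub_nonneg.2 h)
        have a3 := mul_le_mul_of_nonneg_left h3 (sub_nonneg.2 h)
        linarith
      have := le_of_mul_le_mul_left key (by linarith)
      linarith

/-- For predictions on the grid, where bin `j` has the best response with utility line
`α j + g j * x` and `σ` replaces it by the line `β j + γ j * x`, the total gain is at most twice
the largest threshold loss, up to one grid step. -/
theorem sum_gain_le {m : ℕ} (hm : 0 < m) {α g β γ P Q : ℕ → ℝ}
    (htan : ∀ i ≤ m, ∀ j ≤ m, α i + g i * (j / m) ≤ α j + g j * (j / m))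
    (hσ : ∀ i ≤ m, ∀ j ≤ m, β i + γ i * (j / m) ≤ α j + g j * (j / m))
    (hg : ∀ j ≤ m, |g j| ≤ 1) (hP : ∀ j, 0 ≤ P j) (hP1 : ∑ j ∈ Finset.Icc 0 m, P j ≤ 1)
    (hQ0 : ∀ j, 0 ≤ Q j) (hQ : ∀ j, Q j ≤ P j) {B : ℝ}
    (hB : ∀ l < m, gridLoss m P Q l ≤ B) :
    ∑ j ∈ Finset.Icc 0 m, ((β j - α j) * P j + (γ j - g j) * Q j) ≤ 2 * (B + 1 / m) := by
  have hm' : (0 : ℝ) < m := by exact_mod_cast hm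
  set w : ℕ → ℝ := fun l => g (l + 1) - g l with hw
  set a : ℕ → ℝ := fun l => (α (l + 1) + g (l + 1) * (((l : ℝ) + 1) / m))
    - (α l + g l * (((l : ℝ) + 1) / m)) with ha
  set b : ℕ → ℝ := fun l => (α l + g l * ((l : ℝ) / m))
    - (α (l + 1) + g (l + 1) * ((l : ℝ) / m)) with hb
  have hab : ∀ l, a l + b l = w l * (1 / m) := fun l => by
    simp only [ha, hb, hw]
    ring
  have ha0 : ∀ l < m, 0 ≤ a l := fun l hl => by
    have := htan l (by omega) (l + 1) (by omega)
    push_cast at this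
    exact sub_nonneg.2 this
  have hb0 : ∀ l < m, 0 ≤ b l := fun l hl => sub_nonneg.2 (htan (l + 1) (by omega) l (by omega))
  have hw0 : ∀ l < m, 0 ≤ w l := fun l hl => by
    have h1 : 0 ≤ w l * (1 / m) := by
      rw [← hab]
      exact add_nonneg (ha0 l hl) (hb0 l hl)
    exact nonneg_of_mul_nonneg_left h1 (by positivity)
  have hB0 : 0 ≤ B := le_trans (add_nonneg (Finset.sum_nonneg fun _ _ => le_max_right _ _)
    (Finset.sum_nonneg fun _ _ => le_max_right _ _)) (hB 0 hm)
  -- The gain of a single bin, as a sum over all threshold cells.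
  have hbin : ∀ j ∈ Finset.Icc 0 m, (β j - α j) * P j + (γ j - g j) * Q j
      ≤ ∑ l ∈ Finset.range m, (if j ≤ l then
          w l * max (Q j - ((l : ℝ) + 1) / m * P j) 0 + a l * P j
        else w l * max ((l : ℝ) / m * P j - Q j) 0 + b l * P j) := by
    intro j hj
    have hjm := (Finset.mem_Icc.1 hj).2
    have hnn : ∀ l ∈ Finset.range m, 0 ≤ (if j ≤ l then
          w l * max (Q j - ((l : ℝ) + 1) / m * P j) 0 + a l * P j
        else w l * max ((l : ℝ) / m * P j - Q j) 0 + b l * P j) := by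
      intro l hl
      have hl' := Finset.mem_range.1 hl
      split_ifs
      · exact add_nonneg (mul_nonneg (hw0 l hl') (le_max_right _ _))
          (mul_nonneg (ha0 l hl') (hP j))
      · exact add_nonneg (mul_nonneg (hw0 l hl') (le_max_right _ _))
          (mul_nonneg (hb0 l hl') (hP j))
    rcases (hP j).eq_or_lt with h0 | hpos
    · have : Q j = 0 := le_antisymm ((hQ j).trans h0.symm.le) (hQ0 j)
      rw [← h0, this]
      simp
    set q := Q j / P j with hq
    have hQq : Q j = q * P j := (div_mul_cancel₀ _ hpos.ne').symm
    have hq0 : 0 ≤ q := div_nonneg (hQ0 j) hpos.le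
    have hq1 : q ≤ 1 := div_le_one_of_le₀ (hQ j) hpos.le
    have hlhs : (β j - α j) * P j + (γ j - g j) * Q j
        = ((β j + γ j * q) - (α j + g j * q)) * P j := by
      rw [hQq]
      ring
    rw [hlhs]
    rcases le_total ((j : ℝ) / m) q with h | h
    · refine (mul_le_mul_of_nonneg_right (affine_sub_tangent_le_right hm htan (hσ j hjm) hq1 hjm h)
        hpos.le).trans ?_
      rw [Finset.sum_mul]
      refine le_trans (Finset.sum_le_sum fun l hl => le_of_eq ?_)
        (Finset.sum_le_sum_of_subset_of_nonneg (s := Finset.Ico j m) ?_ fun l hl _ => hnn l hl)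
      · rw [if_pos (Finset.mem_Ico.1 hl).1, add_mul, mul_assoc, max_mul_of_nonneg _ _ hpos.le,
          zero_mul, sub_mul q, ← hQq]
      · intro l hl
        exact Finset.mem_range.2 (Finset.mem_Ico.1 hl).2
    · refine (mul_le_mul_of_nonneg_right (affine_sub_tangent_le_left hm htan (hσ j hjm) hq0 hjm h)
        hpos.le).trans ?_
      rw [Finset.sum_mul]
      refine le_trans (Finset.sum_le_sum fun l hl => le_of_eq ?_)
        (Finset.sum_le_sum_of_subset_of_nonneg (s := Finset.range j) ?_ fun l hl _ => hnn l hl)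
      · have := Finset.mem_range.1 hl
        rw [if_neg (by omega), add_mul, mul_assoc, max_mul_of_nonneg _ _ hpos.le,
          zero_mul, sub_mul _ q, ← hQq]
      · exact Finset.range_subset_range.2 hjm
  refine (Finset.sum_le_sum hbin).trans ?_
  rw [Finset.sum_comm]
  have hcell : ∀ l ∈ Finset.range m, ∑ j ∈ Finset.Icc 0 m, (if j ≤ l then
          w l * max (Q j - ((l : ℝ) + 1) / m * P j) 0 + a l * P j
        else w l * max ((l : ℝ) / m * P j - Q j) 0 + b l * P j) ≤ w l * (B + 1 / m) := by
    intro l hl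
    have hl' := Finset.mem_range.1 hl
    have hsplit : ∀ j, (if j ≤ l then
          w l * max (Q j - ((l : ℝ) + 1) / m * P j) 0 + a l * P j
        else w l * max ((l : ℝ) / m * P j - Q j) 0 + b l * P j)
        ≤ w l * ((if j ≤ l then (1 : ℝ) else 0) * max (Q j - ((l : ℝ) + 1) / m * P j) 0)
          + w l * ((1 - if j ≤ l then (1 : ℝ) else 0) * max ((l : ℝ) / m * P j - Q j) 0)
          + w l * (1 / m) * P j := by
      intro j
      rw [← hab]
      have h1 := mul_nonneg (ha0 l hl') (hP j)
      have h2 := mul_nonneg (hb0 l hl') (hP j)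
      split_ifs <;> linarith
    refine (Finset.sum_le_sum fun j _ => hsplit j).trans ?_
    rw [Finset.sum_add_distrib, Finset.sum_add_distrib, ← Finset.mul_sum, ← Finset.mul_sum,
      ← Finset.mul_sum, ← sum_Icc_eq_sum_ite m l hl'.le, ← sum_Icc_succ_eq_sum_ite, ← mul_add]
    have h1 := mul_le_mul_of_nonneg_left (hB l hl') (hw0 l hl')
    have h2 := mul_le_mul_of_nonneg_left hP1
      (mul_nonneg (hw0 l hl') (by positivity : (0 : ℝ) ≤ 1 / m))
    rw [gridLoss] at h1
    linarith
  refine (Finset.sum_le_sum hcell).trans ?_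
  rw [← Finset.sum_mul, Finset.sum_range_sub]
  refine mul_le_mul_of_nonneg_right ?_ (by positivity)
  have h1 := (abs_le.1 (hg m le_rfl)).2
  have h2 := (abs_le.1 (hg 0 (by omega))).1
  linarith

/-! ### Binned masses of an empirical distribution -/

theorem expect_eq_toReal {X : Type*} (D : PMF X) {f : X → ℝ} (hf : ∀ x, 0 ≤ f x) :
    expect D f = (∑' x, D x * ENNReal.ofReal (f x)).toReal := by
  rw [ENNReal.tsum_toReal_eq fun x => ENNReal.mul_ne_top (D.apply_ne_top x) ENNReal.ofReal_ne_top]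
  simp only [expect, ENNReal.toReal_mul, ENNReal.toReal_ofReal (hf _)]

/-- A bounded non-negative function can be integrated against a mixture in two stages. -/
theorem expect_bind {X Y : Type*} (D : PMF X) (k : X → PMF Y) {f : Y → ℝ} (h0 : ∀ y, 0 ≤ f y)
    (h1 : ∀ y, f y ≤ 1) : expect (D.bind k) f = expect D fun x => expect (k x) f := by
  have hfin : ∀ x, ∑' y, k x y * ENNReal.ofReal (f y) ≠ ⊤ := fun x => by
    refine ne_top_of_le_ne_top ENNReal.one_ne_top ?_
    calc _ ≤ ∑' y, k x y := ENNReal.tsum_le_tsum fun y =>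
          mul_le_of_le_one_right (by simp) (by simpa using h1 y)
      _ = 1 := (k x).tsum_coe
  rw [expect_eq_toReal _ h0, expect_eq_toReal D fun x => by
    rw [expect_eq_toReal _ h0]
    exact ENNReal.toReal_nonneg]
  congr 1
  simp_rw [expect_eq_toReal _ h0, ENNReal.ofReal_toReal (hfin _), PMF.bind_apply, ← ENNReal.tsum_mul_right,
    ← ENNReal.tsum_mul_left, mul_assoc]
  exact ENNReal.tsum_comm

theorem expect_map {X Y : Type*} [Fintype X] (D : PMF X) (g : X → Y) (f : Y → ℝ) :
    expect (D.map g) f = ∑ x, (D x).toReal * f (g x) := by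
  classical
  have h : ∀ y, ((D.map g) y).toReal * f y
      = ∑ x, if y = g x then (D x).toReal * f (g x) else 0 := fun y => by
    rw [PMF.map_apply, tsum_fintype, ENNReal.toReal_sum fun x _ => by
      split_ifs
      · exact D.apply_ne_top x
      · simp, Finset.sum_mul]
    refine Finset.sum_congr rfl fun x _ => ?_
    split_ifs with hx
    · rw [hx]
    · simp
  rw [expect]
  simp_rw [h]
  exact (hasSum_sum fun x _ => hasSum_ite_eq (g x) ((D x).toReal * f (g x))).tsum_eq

variable {T : ℕ}

theorem expect_empirical [NeZero T] (p : Fin T → unitInterval) (y : Fin T → Fin 2)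
    (f : Pair → ℝ) : expect (empirical p y) f = (∑ t, f (p t, y t)) / T := by
  rw [empirical, expect_map, Finset.sum_div]
  simp [div_eq_inv_mul]

theorem expect_tau_map (m : ℕ) (p : unitInterval) (b : Fin 2) (f : Pair → ℝ) :
    expect ((tau m p).map fun p' => (p', b)) f
      = Int.fract ((m : ℝ) * p) * f (gridAbove m p, b)
        + (1 - Int.fract ((m : ℝ) * p)) * f (gridBelow m p, b) := by
  rw [tau, PMF.map_comp, expect_map, Fintype.sum_bool]
  have h := (Int.fract_lt_one ((m : ℝ) * p)).le
  simp [fractCoin, ENNReal.toReal_ofReal (Int.fract_nonneg _),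
    ENNReal.toReal_ofReal (sub_nonneg.2 h)]

theorem hat_natCast_sub (n j : ℕ) : hat ((n : ℝ) - j) = if n = j then 1 else 0 := by
  rcases lt_trichotomy n j with h | h | h
  · have : (n : ℝ) + 1 ≤ j := by exact_mod_cast h
    rw [if_neg h.ne, hat_of_le_neg_one (by linarith)]
  · rw [if_pos h, h, hat]
    simp
  · have : (j : ℝ) + 1 ≤ n := by exact_mod_cast h
    rw [if_neg h.ne', hat_of_one_le (by linarith)]

/-- Rounding `x` to an adjacent integer with the right mean hits `j` with probability
`hat (x - j)`. -/
theorem fract_mul_hat_add {x : ℝ} (hx : 0 ≤ x) (j : ℕ) :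
    Int.fract x * hat ((⌈x⌉₊ : ℝ) - j) + (1 - Int.fract x) * hat ((⌊x⌋₊ : ℝ) - j)
      = hat (x - j) := by
  have hfl : (⌊x⌋₊ : ℝ) = x - Int.fract x := by
    rw [natCast_floor_eq_intCast_floor hx, Int.self_sub_fract]
  rcases eq_or_ne (Int.fract x) 0 with h0 | h0
  · rw [h0, hfl, h0]
    ring_nf
  have hpos : 0 < Int.fract x := lt_of_le_of_ne (Int.fract_nonneg x) h0.symm
  have hce : ⌈x⌉₊ = ⌊x⌋₊ + 1 := by
    refine le_antisymm (Nat.ceil_le_floor_add_one x) ?_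
    rw [Nat.succ_le_iff, Nat.lt_ceil, hfl]
    linarith
  have haff := hat_div_affine 1 j ⌊x⌋₊ one_pos (Int.fract x) hpos.le (Int.fract_lt_one x).le
  rw [hce]
  push_cast at haff ⊢
  rw [div_one, div_one, div_one, hfl] at haff
  rw [hfl]
  rw [show x - Int.fract x + Int.fract x = x by ring] at haff
  rw [haff]
  ring

/-- The mass that the observations `t`, each of value `v t`, put on bin `j` of the grid
`{0, 1/m, …, 1}` after splitting each prediction between the two adjacent grid points. For
predictions on the grid there is no splitting. -/
noncomputable def binMass (m : ℕ) (p : Fin T → unitInterval) (v : Fin T → ℝ) (j : ℕ) : ℝ :=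
  (∑ t, v t * hat (m * p t - j)) / T

/-- The outcomes as real numbers. -/
def outcome (y : Fin T → Fin 2) (t : Fin T) : ℝ := ((y t : ℕ) : ℝ)

theorem outcome_nonneg (y : Fin T → Fin 2) (t : Fin T) : 0 ≤ outcome y t := Nat.cast_nonneg _

theorem outcome_le_one (y : Fin T → Fin 2) (t : Fin T) : outcome y t ≤ 1 := by
  have : (y t : ℕ) ≤ 1 := by omega
  rw [outcome]
  exact_mod_cast this

theorem binMass_nonneg (m : ℕ) (p : Fin T → unitInterval) {v : Fin T → ℝ} (hv : ∀ t, 0 ≤ v t)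
    (j : ℕ) : 0 ≤ binMass m p v j :=
  div_nonneg (Finset.sum_nonneg fun t _ => mul_nonneg (hv t) (hat_nonneg _)) (Nat.cast_nonneg _)

theorem binMass_mono (m : ℕ) (p : Fin T → unitInterval) {v w : Fin T → ℝ} (h : ∀ t, v t ≤ w t)
    (j : ℕ) : binMass m p v j ≤ binMass m p w j :=
  div_le_div_of_nonneg_right
    (Finset.sum_le_sum fun t _ => mul_le_mul_of_nonneg_right (h t) (hat_nonneg _))
    (Nat.cast_nonneg _)

theorem sum_binMass_one_le (m : ℕ) (p : Fin T → unitInterval) :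
    ∑ j ∈ Finset.Icc 0 m, binMass m p 1 j ≤ 1 := by
  simp_rw [binMass]
  rw [← Finset.sum_div, Finset.sum_comm]
  refine div_le_one_of_le₀ ?_ (Nat.cast_nonneg _)
  calc _ ≤ ∑ _t : Fin T, (1 : ℝ) := Finset.sum_le_sum fun t _ => ?_
    _ = T := by simp
  simp_rw [Pi.one_apply, one_mul]
  rw [sum_hat m (mul_nonneg (Nat.cast_nonneg m) (p t).2.1)]
  exact min_le_left _ _

theorem binMass_one_le (m : ℕ) (p : Fin T → unitInterval) (j : ℕ) : binMass m p 1 j ≤ 1 := by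
  refine div_le_one_of_le₀ ?_ (Nat.cast_nonneg _)
  calc _ ≤ ∑ _t : Fin T, (1 : ℝ) := Finset.sum_le_sum fun t _ => by
        simpa using hat_le_one _
    _ = T := by simp

theorem binMass_refine {m R : ℕ} (hR : 0 < R) (p : Fin T → unitInterval) (v : Fin T → ℝ)
    (j : ℕ) : binMass m p v j
      = ∑ l ∈ Finset.Icc 0 (m * R), hat ((l : ℝ) / R - j) * binMass (m * R) p v l := by
  have hR' : (R : ℝ) ≠ 0 := by exact_mod_cast hR.ne'
  have h : ∀ t, hat ((m : ℝ) * p t - j) = ∑ l ∈ Finset.Icc 0 (m * R),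
      hat ((l : ℝ) / R - j) * hat (((m * R : ℕ) : ℝ) * p t - l) := fun t => by
    rw [sum_hat_mul_hat R j (m * R) hR (mul_nonneg (Nat.cast_nonneg _) (p t).2.1)
      (mul_le_of_le_one_right (Nat.cast_nonneg _) (p t).2.2)]
    congr 2
    push_cast
    field_simp
  simp_rw [binMass, h, mul_div_assoc', ← Finset.sum_div, Finset.mul_sum]
  rw [Finset.sum_comm]
  congr 1
  exact Finset.sum_congr rfl fun l _ => Finset.sum_congr rfl fun t _ => by ring

theorem expect_roundedDist [NeZero T] {m : ℕ} (hm : 0 < m) (p : Fin T → unitInterval)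
    (y : Fin T → Fin 2) (j : ℕ) {g : Fin 2 → ℝ} (h0 : ∀ b, 0 ≤ g b) (h1 : ∀ b, g b ≤ 1) :
    expect (roundedDist m (empirical p y))
      (fun x => if (x.1 : ℝ) = (j : ℝ) / m then g x.2 else 0)
      = binMass m p (fun t => g (y t)) j := by
  have hm' : (m : ℝ) ≠ 0 := by exact_mod_cast hm.ne'
  rw [roundedDist, expect_bind _ _ (fun x => by split_ifs <;> simp [h0])
    (fun x => by split_ifs <;> simp [h1]), expect_empirical, binMass]
  congr 1
  refine Finset.sum_congr rfl fun t _ => ?_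
  rw [expect_tau_map, ← fract_mul_hat_add (mul_nonneg (Nat.cast_nonneg m) (p t).2.1) j,
    hat_natCast_sub, hat_natCast_sub]
  simp only [gridAbove, gridBelow, div_left_inj' hm', Nat.cast_inj]
  split_ifs <;> ring

theorem binWeight_empirical [NeZero T] {m : ℕ} (hm : 0 < m) (p : Fin T → unitInterval)
    (y : Fin T → Fin 2) (j : ℕ) : binWeight m (empirical p y) j = binMass m p 1 j :=
  expect_roundedDist hm p y j (g := fun _ => 1) (fun _ => zero_le_one) fun _ => le_rfl

theorem binMean_empirical [NeZero T] {m : ℕ} (hm : 0 < m) (p : Fin T → unitInterval)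
    (y : Fin T → Fin 2) (j : ℕ) :
    binMean m (empirical p y) j = binMass m p (outcome y) j / binMass m p 1 j := by
  rw [binMean, binWeight_empirical hm, expect_roundedDist hm p y j (g := fun b => ((b : ℕ) : ℝ))
    (fun _ => Nat.cast_nonneg _) fun b => by exact_mod_cast (by omega : (b : ℕ) ≤ 1)]
  rfl

theorem binMass_outcome_le (m : ℕ) (p : Fin T → unitInterval) (y : Fin T → Fin 2) (j : ℕ) :
    binMass m p (outcome y) j ≤ binMass m p 1 j :=
  binMass_mono m p (outcome_le_one y) j

theorem binMass_outcome_nonneg (m : ℕ) (p : Fin T → unitInterval) (y : Fin T → Fin 2) (j : ℕ) :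
    0 ≤ binMass m p (outcome y) j :=
  binMass_nonneg m p (outcome_nonneg y) j

theorem binMass_one_nonneg (m : ℕ) (p : Fin T → unitInterval) (j : ℕ) :
    0 ≤ binMass m p 1 j :=
  binMass_nonneg m p (fun _ => zero_le_one) j

theorem scfdl_empirical [NeZero T] {m : ℕ} (hm : 0 < m) (p : Fin T → unitInterval)
    (y : Fin T → Fin 2) (i : ℕ) :
    scfdl m (empirical p y) i = gridLoss m (binMass m p 1) (binMass m p (outcome y)) i := by
  have hmul : ∀ j, binMass m p 1 j * (binMass m p (outcome y) j / binMass m p 1 j)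
      = binMass m p (outcome y) j := fun j => by
    rcases eq_or_ne (binMass m p 1 j) 0 with h | h
    · rw [h, zero_mul]
      exact le_antisymm (binMass_outcome_nonneg m p y j)
        ((binMass_outcome_le m p y j).trans h.le)
    · exact mul_div_cancel₀ _ h
  rw [scfdl, gridLoss]
  simp_rw [binWeight_empirical hm, binMean_empirical hm,
    mul_max_of_nonneg _ _ (binMass_one_nonneg m p _), mul_sub, hmul, mul_zero,
    mul_comm (binMass m p 1 _) (_ / (m : ℝ))]

/-- The infimum defining `scdl` is approached on scales at least as fine as `m`, and refining the
binning does not decrease the loss. -/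
theorem gridLoss_le_scdl [NeZero T] (p : Fin T → unitInterval) (y : Fin T → Fin 2) {m k : ℕ}
    (hmk : m = 2 ^ k) (hs : scdl (empirical p y) < 2 / (m : ℝ)) {i : ℕ} (hi : i < m) :
    gridLoss m (binMass m p 1) (binMass m p (outcome y)) i ≤ scdl (empirical p y) := by
  have hm : 0 < m := by rw [hmk]; positivity
  have hm' : (0 : ℝ) < m := by exact_mod_cast hm
  refine le_of_forall_gt_imp_ge_of_dense fun x hx => ?_
  obtain ⟨n, hn⟩ := exists_lt_of_ciInf_lt (lt_min hx hs)
  obtain ⟨hn1, hn2⟩ := lt_min_iff.1 hn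
  have hscale : k ≤ n + 1 := by
    by_contra hcon
    have h1 : (2 : ℝ) ^ (n + 1) * 2 ≤ m := by
      rw [hmk, ← pow_succ]
      push_cast
      exact pow_le_pow_right₀ one_le_two (by omega)
    have h2 := (le_max_right _ _).trans_lt hn2
    rw [div_lt_div_iff₀ (by positivity) hm'] at h2
    linarith
  have hfine : (2 : ℕ) ^ (n + 1) = m * 2 ^ (n + 1 - k) := by
    rw [hmk, ← pow_add]
    congr 1
    omega
  rw [hfine] at hn1
  refine gridLoss_le_of_refine (R := 2 ^ (n + 1 - k)) (by positivity)
    (binMass_one_nonneg _ p) (binMass_refine (by positivity) p 1)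
    (binMass_refine (by positivity) p _) (fun l hl => ?_) hi
  rw [← scfdl_empirical (by positivity)]
  exact (Finset.le_sup' (scfdl _ _) (Finset.mem_Icc.2 ⟨l.zero_le, hl⟩)).trans
    ((le_max_left _ _).trans hn1.le)

/-- On the grid, the calibration decision loss is at most twice the largest threshold loss, up to
one grid step. -/
theorem cdl_empirical_le [NeZero T] {m : ℕ} (hm : 0 < m) (p : Fin T → unitInterval)
    (y : Fin T → Fin 2) (hp : ∀ t, ∃ n ≤ m, (p t : ℝ) = (n : ℝ) / m) {B : ℝ}
    (hB : ∀ i < m, gridLoss m (binMass m p 1) (binMass m p (outcome y)) i ≤ B) :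
    cdl.{u} (empirical p y) ≤ 2 * (B + 1 / m) := by
  have hm' : (0 : ℝ) < m := by exact_mod_cast hm
  refine csSup_le (bestResponseRegrets_nonempty _) ?_
  rintro _ ⟨Z, r, hr, rfl⟩
  have : Nonempty (Z.A → Z.A) := ⟨id⟩
  refine ciSup_le fun σ => ?_
  set x : ℕ → unitInterval := fun j => Set.projIcc 0 1 zero_le_one ((j : ℝ) / m) with hx
  have hxj : ∀ j ≤ m, (x j : ℝ) = (j : ℝ) / m := fun j hj => by
    have : (j : ℝ) / m ∈ Set.Icc (0 : ℝ) 1 :=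
      ⟨by positivity, div_le_one_of_le₀ (by exact_mod_cast hj) hm'.le⟩
    simp only [hx]
    rw [Set.projIcc_of_mem _ this]
  have hbr : ∀ a, ∀ j ≤ m, Z.U a 0 + (Z.U a 1 - Z.U a 0) * ((j : ℝ) / m)
      ≤ Z.U (r (x j)) 0 + (Z.U (r (x j)) 1 - Z.U (r (x j)) 0) * ((j : ℝ) / m) := fun a j hj => by
    have := hr (x j) a
    simp only [DecisionTask.expectedUtility, hxj j hj] at this
    linarith
  refine le_trans (le_of_eq ?_) (sum_gain_le hm (α := fun j => Z.U (r (x j)) 0)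
    (g := fun j => Z.U (r (x j)) 1 - Z.U (r (x j)) 0)
    (β := fun j => Z.U (σ (r (x j))) 0)
    (γ := fun j => Z.U (σ (r (x j))) 1 - Z.U (σ (r (x j))) 0)
    (fun i _ j hj => hbr _ j hj) (fun i _ j hj => hbr _ j hj) (fun j _ => ?_)
    (binMass_one_nonneg m p) (sum_binMass_one_le m p) (binMass_outcome_nonneg m p y)
    (binMass_outcome_le m p y) hB)
  · rw [expect_empirical]
    simp_rw [binMass, mul_div_assoc', ← add_div, ← Finset.sum_div, Finset.mul_sum,
      ← Finset.sum_add_distrib]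
    rw [Finset.sum_comm]
    congr 1
    refine Finset.sum_congr rfl fun t _ => ?_
    obtain ⟨n, hn, hpn⟩ := hp t
    have hpt : p t = x n := Subtype.ext (by rw [hpn, hxj n hn])
    have hhat : ∀ j : ℕ, hat ((m : ℝ) * p t - j) = if n = j then 1 else 0 := fun j => by
      rw [hpn, mul_div_cancel₀ _ hm'.ne', hat_natCast_sub]
    simp_rw [hhat]
    rw [Finset.sum_eq_single n (fun j _ hj => by rw [if_neg hj.symm]; ring)
      (fun h => absurd (Finset.mem_Icc.2 ⟨n.zero_le, hn⟩) h), if_pos rfl, hpt]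
    obtain h | h : y t = 0 ∨ y t = 1 := by omega
    · simp [h, outcome]
    · simp [h, outcome]
      ring
  · have h0 := Z.bounded (r (x j)) 0
    have h1 := Z.bounded (r (x j)) 1
    exact abs_le.2 ⟨by linarith [h0.2, h1.1], by linarith [h0.1, h1.2]⟩

/-! ### Concentration of the bin masses under independent rounding -/

theorem toMeasure_tau (m : ℕ) (p : unitInterval) :
    (tau m p).toMeasure = (fractCoin ((m : ℝ) * p)).toMeasure.map
      fun b => if b = true then gridAbove m p else gridBelow m p := by
  rw [tau, PMF.toMeasure_map]
  exact measurable_from_top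

theorem integral_tau (m : ℕ) (p : unitInterval) {g : unitInterval → ℝ} (hg : Measurable g) :
    ∫ x, g x ∂(tau m p).toMeasure = Int.fract ((m : ℝ) * p) * g (gridAbove m p)
      + (1 - Int.fract ((m : ℝ) * p)) * g (gridBelow m p) := by
  rw [toMeasure_tau, integral_map measurable_from_top.aemeasurable hg.aestronglyMeasurable,
    PMF.integral_eq_sum, Fintype.sum_bool]
  have h := (Int.fract_lt_one ((m : ℝ) * p)).le
  simp [fractCoin, ENNReal.toReal_ofReal (Int.fract_nonneg _),
    ENNReal.toReal_ofReal (sub_nonneg.2 h)]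

theorem ae_tau_mem_grid {m : ℕ} (p : unitInterval) :
    ∀ᵐ x : unitInterval ∂(tau m p).toMeasure, ∃ n ≤ m, (x : ℝ) = (n : ℝ) / m := by
  have hs : MeasurableSet {x : unitInterval | ∃ n ≤ m, (x : ℝ) = (n : ℝ) / m} := by
    have : {x : unitInterval | ∃ n ≤ m, (x : ℝ) = (n : ℝ) / m}
        = ⋃ n ∈ Finset.Icc 0 m, {x : unitInterval | (x : ℝ) = (n : ℝ) / m} := by
      ext x
      simp
    rw [this]
    exact Finset.measurableSet_biUnion _ fun n _ =>
      measurableSet_eq_fun measurable_subtype_coe measurable_const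
  rw [toMeasure_tau, ae_map_iff measurable_from_top.aemeasurable hs]
  refine Filter.Eventually.of_forall fun b => ?_
  have hle : (m : ℝ) * p ≤ m := mul_le_of_le_one_right (Nat.cast_nonneg m) p.2.2
  cases b
  · exact ⟨⌊(m : ℝ) * p⌋₊, Nat.floor_le_of_le hle, rfl⟩
  · exact ⟨⌈(m : ℝ) * p⌉₊, Nat.ceil_le.2 hle, rfl⟩

theorem measurable_hat : Measurable hat := by
  unfold hat
  fun_prop

theorem exp_mul_hat_le {l v h : ℝ} (hl0 : 0 ≤ l) (hl1 : l ≤ 1) (hv : |v| ≤ 1) (h0 : 0 ≤ h)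
    (h1 : h ≤ 1) : Real.exp (l * (v * h)) ≤ 1 + (l * v + l ^ 2) * h := by
  have habs : |l * (v * h)| ≤ 1 := by
    rw [abs_mul, abs_mul, abs_of_nonneg hl0, abs_of_nonneg h0]
    exact mul_le_one₀ hl1 (by positivity) (mul_le_one₀ hv h0 h1)
  have := (abs_le.1 (Real.abs_exp_sub_one_sub_id_le habs)).2
  have hv2 : v ^ 2 ≤ 1 := by rwa [sq_le_one_iff_abs_le_one]
  have hsq : (l * (v * h)) ^ 2 ≤ l ^ 2 * h := by
    have e1 : v ^ 2 * h ^ 2 ≤ 1 * h := by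
      refine mul_le_mul hv2 ?_ (by positivity) zero_le_one
      nlinarith
    calc (l * (v * h)) ^ 2 = l ^ 2 * (v ^ 2 * h ^ 2) := by ring
      _ ≤ l ^ 2 * (1 * h) := by gcongr
      _ = _ := by ring
  linarith

/-- Bernstein-type bound: the variance of the mass of bin `j` is at most its expected weight, so
the deviation at rate `l` is `l` times this weight, plus a term from the tail probability. -/
theorem measure_binMass_ge_le [NeZero T] {m : ℕ} {p : Fin T → unitInterval}
    {Ω : Type v} [MeasurableSpace Ω] {μ : Measure Ω} [IsProbabilityMeasure μ]
    {p' : Fin T → Ω → unitInterval} (hlaw : ∀ t, HasLaw (p' t) (tau m (p t)).toMeasure μ)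
    (hind : iIndepFun p' μ) {v : Fin T → ℝ} (hv : ∀ t, |v t| ≤ 1) (j : ℕ) {l : ℝ} (hl0 : 0 < l)
    (hl1 : l ≤ 1) (L : ℝ) :
    μ.real {ω | binMass m p v j + l * binMass m p 1 j + L / T / l
      ≤ binMass m (fun t => p' t ω) v j} ≤ Real.exp (-L) := by
  have hT : (0 : ℝ) < T := by exact_mod_cast Nat.pos_of_ne_zero (NeZero.ne T)
  set f : Fin T → unitInterval → ℝ := fun t x => v t * hat (m * x - j) with hf
  have hfm : ∀ t, Measurable (f t) := fun t =>
    (measurable_hat.comp (by fun_prop)).const_mul _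
  set X : Fin T → Ω → ℝ := fun t ω => f t (p' t ω) with hX
  have hXm : ∀ t, AEMeasurable (X t) μ := fun t => (hfm t).comp_aemeasurable (hlaw t).aemeasurable
  have hXind : iIndepFun X μ := hind.comp f hfm
  have hXle : ∀ t ω, |X t ω| ≤ 1 := fun t ω => by
    simp only [hX, hf]
    rw [abs_mul, abs_of_nonneg (hat_nonneg _)]
    exact mul_le_one₀ (hv t) (hat_nonneg _) (hat_le_one _)
  have hmgf : ∀ t, mgf (X t) μ l ≤ Real.exp ((l * v t + l ^ 2) * hat (m * p t - j)) := by
    intro t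
    have hx : 0 ≤ (m : ℝ) * p t := mul_nonneg (Nat.cast_nonneg m) (p t).2.1
    have hgm : Measurable fun x => Real.exp (l * f t x) := ((hfm t).const_mul l).exp
    have h1 : mgf (X t) μ l = ∫ x, Real.exp (l * f t x) ∂(tau m (p t)).toMeasure := by
      rw [mgf, ← (hlaw t).integral_comp hgm.aestronglyMeasurable]
      rfl
    have hle : ∀ x, Real.exp (l * f t x) ≤ 1 + (l * v t + l ^ 2) * hat (m * x - j) := fun x =>
      exp_mul_hat_le hl0.le hl1 (hv t) (hat_nonneg _) (hat_le_one _)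
    have hfr0 := Int.fract_nonneg ((m : ℝ) * p t)
    have hfr1 := (Int.fract_lt_one ((m : ℝ) * p t)).le
    have hmean : Int.fract ((m : ℝ) * p t) * hat (m * gridAbove m (p t) - j)
        + (1 - Int.fract ((m : ℝ) * p t)) * hat (m * gridBelow m (p t) - j)
        = hat (m * p t - j) := by
      rw [← fract_mul_hat_add hx j]
      rcases Nat.eq_zero_or_pos m with h0 | h0
      · simp [h0]
      · have hm' : (m : ℝ) ≠ 0 := by exact_mod_cast h0.ne'
        simp only [gridAbove, gridBelow, mul_div_cancel₀ _ hm']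
    rw [h1, integral_tau m (p t) hgm]
    have e1 := mul_le_mul_of_nonneg_left (hle (gridAbove m (p t))) hfr0
    have e2 := mul_le_mul_of_nonneg_left (hle (gridBelow m (p t))) (sub_nonneg.2 hfr1)
    have e3 := Real.add_one_le_exp ((l * v t + l ^ 2) * hat (m * p t - j))
    rw [← hmean] at e3 ⊢
    linarith
  have hsum : mgf (∑ t, X t) μ l
      ≤ Real.exp (T * (l * binMass m p v j + l ^ 2 * binMass m p 1 j)) := by
    rw [hXind.mgf_sum₀ hXm]
    refine (Finset.prod_le_prod (fun _ _ => mgf_nonneg) fun t _ => hmgf t).trans (le_of_eq ?_)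
    rw [← Real.exp_sum]
    congr 1
    simp only [binMass, Pi.one_apply, one_mul]
    rw [mul_add, mul_left_comm _ l, mul_left_comm _ (l ^ 2), mul_div_cancel₀ _ hT.ne',
      mul_div_cancel₀ _ hT.ne', Finset.mul_sum, Finset.mul_sum, ← Finset.sum_add_distrib]
    exact Finset.sum_congr rfl fun t _ => by ring
  have hint : Integrable (fun ω => Real.exp (l * (∑ t, X t) ω)) μ := by
    refine Integrable.of_bound (C := Real.exp (l * T))
      ((Finset.aemeasurable_sum _ fun t _ => hXm t).const_mul l).exp.aestronglyMeasurable
      (Filter.Eventually.of_forall fun ω => ?_)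
    rw [Real.norm_of_nonneg (Real.exp_pos _).le]
    refine Real.exp_le_exp.2 (mul_le_mul_of_nonneg_left ?_ hl0.le)
    rw [Finset.sum_apply]
    calc ∑ t, X t ω ≤ ∑ _t : Fin T, (1 : ℝ) :=
          Finset.sum_le_sum fun t _ => (abs_le.1 (hXle t ω)).2
      _ = T := by simp
  have hset : {ω | binMass m p v j + l * binMass m p 1 j + L / T / l
      ≤ binMass m (fun t => p' t ω) v j}
      = {ω | T * (binMass m p v j + l * binMass m p 1 j + L / T / l) ≤ (∑ t, X t) ω} := by
    ext ω
    simp only [Set.mem_ofPred_eq, Finset.sum_apply]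
    conv_lhs => rhs; rw [binMass]
    rw [le_div_iff₀ hT, mul_comm]
  rw [hset]
  refine (measure_ge_le_exp_mul_mgf _ hl0.le hint).trans ?_
  refine (mul_le_mul_of_nonneg_left hsum (Real.exp_pos _).le).trans (le_of_eq ?_)
  rw [← Real.exp_add]
  congr 1
  field_simp
  ring

/-- The signed value, relative to the threshold cell `[i/m, (i+1)/m]`, of the observation `t` in
bin `j`. -/
noncomputable def excess (m : ℕ) (y : Fin T → Fin 2) (i j : ℕ) (t : Fin T) : ℝ :=
  if j ≤ i then outcome y t - ((i : ℝ) + 1) / m else (i : ℝ) / m - outcome y t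

theorem abs_excess_le_one {m : ℕ} (y : Fin T → Fin 2) {i : ℕ} (hi : i < m) (j : ℕ)
    (t : Fin T) : |excess m y i j t| ≤ 1 := by
  have hm' : (0 : ℝ) < m := by exact_mod_cast (by omega : 0 < m)
  have h0 := outcome_nonneg y t
  have h1 := outcome_le_one y t
  have h2 : ((i : ℝ) + 1) / m ≤ 1 := by
    rw [div_le_one hm']
    exact_mod_cast hi
  have h3 : (i : ℝ) / m ≤ ((i : ℝ) + 1) / m := by gcongr; linarith
  have h4 : 0 ≤ (i : ℝ) / m := by positivity
  rw [excess, abs_le]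
  split_ifs <;> constructor <;> linarith

theorem binMass_excess_of_le (m : ℕ) (p : Fin T → unitInterval) (y : Fin T → Fin 2)
    {i j : ℕ} (h : j ≤ i) : binMass m p (excess m y i j) j
      = binMass m p (outcome y) j - ((i : ℝ) + 1) / m * binMass m p 1 j := by
  simp only [binMass, excess, if_pos h, mul_div_assoc', ← sub_div, Finset.mul_sum,
    ← Finset.sum_sub_distrib, Pi.one_apply, one_mul, sub_mul]

theorem binMass_excess_of_lt (m : ℕ) (p : Fin T → unitInterval) (y : Fin T → Fin 2)
    {i j : ℕ} (h : i < j) : binMass m p (excess m y i j) j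
      = (i : ℝ) / m * binMass m p 1 j - binMass m p (outcome y) j := by
  simp only [binMass, excess, if_neg (not_le.2 h), mul_div_assoc', ← sub_div, Finset.mul_sum,
    ← Finset.sum_sub_distrib, Pi.one_apply, one_mul, sub_mul]

/-- The distance, in grid steps, of bin `j` from the far end of the threshold cell
`[i/m, (i+1)/m]`. -/
def cellDist (i j : ℕ) : ℕ := if j ≤ i then i + 1 - j else j - i

theorem cellDist_pos (i j : ℕ) : 0 < cellDist i j := by
  rw [cellDist]
  split_ifs <;> omega

theorem cellDist_le {m i j : ℕ} (hi : i < m) (hj : j ≤ m) : cellDist i j ≤ m := by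
  rw [cellDist]
  split_ifs <;> omega

/-- If no bin mass deviates by more than the Bernstein bound, the calibration decision loss of
the rounded predictions is controlled. -/
theorem cdl_le_of_binMass_lt [NeZero T] {m : ℕ} (hm : 2 ≤ m) {p p' : Fin T → unitInterval}
    {y : Fin T → Fin 2} {ε c B : ℝ} (hε : 0 < ε) (hc : 0 < c) (hcε : c * ε ≤ 1 / m)
    (hBm : B ≤ 2 / m)
    (hB : ∀ i < m, gridLoss m (binMass m p 1) (binMass m p (outcome y)) i ≤ B)
    (hgrid : ∀ t, ∃ n ≤ m, (p' t : ℝ) = (n : ℝ) / m)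
    (hdev : ∀ i < m, ∀ j ≤ m, binMass m p' (excess m y i j) j < binMass m p (excess m y i j) j
      + c / 4 * ε * cellDist i j * binMass m p 1 j + 3 * ε ^ 2 / (c / 4 * ε * cellDist i j)) :
    cdl.{u} (empirical p' y)
      ≤ 2 * B + 2 / m + 6 * (13 / 2 * c + 24 / c) * (ε * Real.log m) := by
  have hm' : (0 : ℝ) < m := by exact_mod_cast (by omega : 0 < m)
  have hgl : ∀ i < m, gridLoss m (binMass m p' 1) (binMass m p' (outcome y)) i
      ≤ B + (3 * (c * ε * m) * B + 2 * (c / 4 + 12 / c) * ε) * harmonic m := by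
    intro i hi
    refine (gridLoss_perturb_le hi (binMass_one_nonneg m p) (binMass_one_le m p) hε hc hcε hB
      (fun j hj => ?_) fun j hj hjm => ?_).trans (add_le_add_left (hB i hi) _)
    · have := hdev i hi j (by omega)
      rw [binMass_excess_of_le m p y hj, binMass_excess_of_le m p' y hj, cellDist, if_pos hj] at this
      linarith
    · have := hdev i hi j hjm
      rw [binMass_excess_of_lt m p y hj, binMass_excess_of_lt m p' y hj, cellDist,
        if_neg (by omega)] at this
      linarith
  refine (cdl_empirical_le (by omega) p' y hgrid hgl).trans ?_
  have hH0 : (0 : ℝ) ≤ harmonic m := by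
    rw [harmonic]
    push_cast
    positivity
  have hH : (harmonic m : ℝ) ≤ 3 * Real.log m := by
    have h1 := harmonic_le_one_add_log m
    have h2 : Real.log 2 ≤ Real.log m :=
      Real.log_le_log two_pos (by exact_mod_cast hm)
    have h3 := Real.log_two_gt_d9
    linarith
  have hcoef : 3 * (c * ε * m) * B + 2 * (c / 4 + 12 / c) * ε ≤ (13 / 2 * c + 24 / c) * ε := by
    have h1 : 3 * (c * ε * m) * B ≤ 3 * (c * ε * m) * (2 / m) := by gcongr
    have h2 : 3 * (c * ε * m) * (2 / m) = 6 * c * ε := by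
      field_simp
      norm_num
    have h3 : 2 * (c / 4 + 12 / c) * ε = c / 2 * ε + 24 / c * ε := by ring
    rw [h2] at h1
    rw [h3]
    linarith
  have h1 := mul_le_mul_of_nonneg_right hcoef hH0
  have h2 := mul_le_mul_of_nonneg_left hH (by positivity : 0 ≤ (13 / 2 * c + 24 / c) * ε)
  have h3 : 2 * (1 / (m : ℝ)) = 2 / m := by ring
  linarith

end SoftBinned

theorem theorem4p2 (c : ℝ) (hc : 0 < c) :
    ∃ C : ℝ, 0 < C ∧
      ∀ (T : ℕ) [NeZero T] (p : Fin T → unitInterval) (y : Fin T → Fin 2)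
        (m : ℕ) (_ : ∃ k : ℕ, 1 ≤ k ∧ m = 2 ^ k)
        (_ : scdl (empirical p y) < 2 / (m : ℝ))
        (δ : ℝ) (_ : 0 < δ) (_ : δ < 1 / (2 * (m : ℝ)))
        (_ : c * √(Real.log (1 / δ) / (T : ℝ)) ≤ 1 / (m : ℝ))
        (Ω : Type v) [MeasurableSpace Ω] (μ : Measure Ω) [IsProbabilityMeasure μ]
        (p' : Fin T → Ω → unitInterval)
        (_ : ∀ t, HasLaw (p' t) (tau m (p t)).toMeasure μ)
        (_ : iIndepFun p' μ),
        1 - δ ≤ μ.real {ω | cdl.{u} (empirical (fun t => p' t ω) y) ≤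
          2 * scdl (empirical p y) + 2 / (m : ℝ)
            + C * (√(Real.log (1 / δ) / (T : ℝ)) * Real.log (m : ℝ))} := by
  refine ⟨6 * (13 / 2 * c + 24 / c), by positivity, ?_⟩
  intro T _ p y m ⟨k, hk, hmk⟩ hs δ hδ0 hδ1 hcε Ω _ μ _ p' hlaw hind
  have hm2 : 2 ≤ m := by
    rw [hmk]
    exact Nat.le_self_pow (by omega) 2
  have hm2' : (2 : ℝ) ≤ m := by exact_mod_cast hm2
  have hm' : (0 : ℝ) < m := by linarith
  have hT : (0 : ℝ) < T := by exact_mod_cast Nat.pos_of_ne_zero (NeZero.ne T)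
  have hδm : m * δ < 1 / 2 := by
    rw [lt_div_iff₀ (by positivity)] at hδ1
    linarith
  have hlog : 0 < Real.log (1 / δ) := by
    refine Real.log_pos ?_
    rw [lt_div_iff₀ hδ0]
    nlinarith
  set ε := √(Real.log (1 / δ) / (T : ℝ)) with hε
  have hε0 : 0 < ε := Real.sqrt_pos.2 (by positivity)
  have hε2 : ε ^ 2 = Real.log (1 / δ) / T := Real.sq_sqrt (by positivity)
  have hexp : Real.exp (-(3 * Real.log (1 / δ))) = δ ^ 3 := by
    rw [one_div, Real.log_inv, show -(3 * -Real.log δ) = ((3 : ℕ) : ℝ) * Real.log δ by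
      push_cast; ring, Real.exp_nat_mul, Real.exp_log hδ0]
  -- The failure event of the threshold cell `i` and the bin `j`.
  set bad : ℕ × ℕ → Set Ω := fun x => {ω | binMass m p (excess m y x.1 x.2) x.2
      + c / 4 * ε * cellDist x.1 x.2 * binMass m p 1 x.2
      + 3 * Real.log (1 / δ) / T / (c / 4 * ε * cellDist x.1 x.2)
      ≤ binMass m (fun t => p' t ω) (excess m y x.1 x.2) x.2} with hbad
  -- Since `m * δ < 1 / 2`, probability `δ ^ 3` per event leaves room for all `m * (m + 1)` of them.
  have hbadle : ∀ x ∈ Finset.range m ×ˢ Finset.range (m + 1), μ.real (bad x) ≤ δ ^ 3 := by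
    intro x hx
    obtain ⟨hi, hj⟩ := Finset.mem_product.1 hx
    have hi := Finset.mem_range.1 hi
    have hj := Finset.mem_range.1 hj
    have hd0 : (0 : ℝ) < cellDist x.1 x.2 := by exact_mod_cast cellDist_pos _ _
    have hdm : (cellDist x.1 x.2 : ℝ) ≤ m := by exact_mod_cast cellDist_le hi (by omega)
    rw [← hexp]
    refine measure_binMass_ge_le hlaw hind (abs_excess_le_one y hi x.2) x.2 (by positivity) ?_ _
    rw [le_div_iff₀ hm'] at hcε
    have := mul_le_mul_of_nonneg_left hdm (by positivity : 0 ≤ c * ε)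
    linarith
  set good := {ω | cdl.{u} (empirical (fun t => p' t ω) y) ≤
    2 * scdl (empirical p y) + 2 / (m : ℝ)
      + 6 * (13 / 2 * c + 24 / c) * (ε * Real.log (m : ℝ))} with hgood
  have hae : ∀ᵐ ω ∂μ, ∀ t, ∃ n ≤ m, (p' t ω : ℝ) = (n : ℝ) / m := by
    rw [ae_all_iff]
    intro t
    have := ae_tau_mem_grid (m := m) (p t)
    rw [← (hlaw t).map_eq] at this
    exact ae_of_ae_map (hlaw t).aemeasurable this
  have hcompl : μ.real goodᶜ ≤ δ := by
    have hsub : goodᶜ ≤ᵐ[μ] ⋃ x ∈ Finset.range m ×ˢ Finset.range (m + 1), bad x := by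
      filter_upwards [hae] with ω hω hng
      by_contra hcon
      refine hng (cdl_le_of_binMass_lt hm2 hε0 hc hcε hs.le
        (fun i hi => gridLoss_le_scdl p y hmk hs hi) hω fun i hi j hj => ?_)
      have hnot : ω ∉ bad (i, j) := fun h => hcon (Set.mem_biUnion
        (Finset.mem_coe.2 (Finset.mem_product.2
          ⟨Finset.mem_range.2 hi, Finset.mem_range.2 (by omega)⟩)) h)
      simp only [hbad, Set.mem_ofPred_eq, not_le] at hnot
      rwa [hε2, mul_div_assoc']
    calc μ.real goodᶜ ≤ μ.real (⋃ x ∈ Finset.range m ×ˢ Finset.range (m + 1), bad x) :=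
          ENNReal.toReal_mono (measure_ne_top _ _) (measure_mono_ae hsub)
      _ ≤ ∑ x ∈ Finset.range m ×ˢ Finset.range (m + 1), μ.real (bad x) :=
          measureReal_biUnion_finset_le _ _
      _ ≤ ∑ _x ∈ Finset.range m ×ˢ Finset.range (m + 1), δ ^ 3 := Finset.sum_le_sum hbadle
      _ = (m * δ) * ((m + 1) * δ) * δ := by
          rw [Finset.sum_const, Finset.card_product, Finset.card_range, Finset.card_range,
            nsmul_eq_mul]
          push_cast
          ring
      _ ≤ 1 / 2 * 1 * δ := by
          gcongr
          nlinarith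
      _ ≤ δ := by linarith
  -- The event need not be measurable, so only subadditivity of the outer measure is available.
  have huniv : (1 : ℝ) ≤ μ.real good + μ.real goodᶜ := by
    have := measureReal_union_le (μ := μ) good goodᶜ
    rwa [Set.union_compl_self, probReal_univ] at this
  linarith
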